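/- Work in the two-sorted language $\mathsf{L}_2$ of second-order arithmetic, with signature $\langle 0,1,+,\times,<,=_{\mathbb N},\in\rangle$; equality of sets is an abbreviation for extensional equality. $\mathsf{RCA}_0$ consists of the axioms of a discrete ordered semiring, $\Sigma^0_1$ induction and $\Delta^0_1$ comprehension (all schemes allow number and set parameters); $\mathsf{ACA}_0$ is $\mathsf{RCA}_0$ together with comprehension for all arithmetical formulas. In $\mathsf{RCA}_0$, write $\langle a,b\rangle=(a+b)^2+a$. For $e=\langle k,\langle m,n\rangle\rangle$ let $D_e$ be the finite set of all $i<k$ such that $m(i+1)+1$ divides $n$; $e$ is a canonical index if it is the least number of this form that codes the set $D_e$. A formula $\varphi(X)$ (with one distinguished free set variable $X$) is of finite character if $\varphi(\emptyset)$ holds and, for every set $A$, $\varphi(A)$ holds if and only if $\varphi(F)$ holds for every finite set $F\subseteq A$. A finitary closure operator is a set $D$ all of whose elements are pairs $\langle e,n\rangle$ with $e$ a canonical index; a set $A$ is $D$-closed if for every $\langle e,n\rangle\in D$, $D_e\subseteq A$ implies $n\in A$. For a class $\Gamma$ of formulas, $\Gamma\text{-}\mathsf{CE}$ is the scheme which states,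 for each $\varphi(X)$ in $\Gamma$: if $\varphi$ is of finite character, $D$ is a finitary closure operator and $A$ is any set, then every $D$-closed subset $C$ of $A$ such that $\varphi(C)$ holds is contained in a set $B$ that is $\subseteq$-maximal among the $D$-closed subsets of $A$ satisfying $\varphi$. Here $\Sigma^0_0$ is the class of formulas all of whose quantifiers are bounded number quantifiers, $\Sigma^0_1$ is the class of formulas $(\exists n)\,\theta$ with $\theta$ in $\Sigma^0_0$ (both with arbitrary number and set parameters), and $\mathsf{QF}$ is the class of quantifier-free formulas without parameters, i.e. with $X$ as the only free variable. Theorem. The following are equivalent over $\mathsf{RCA}_0$, that is, every $\mathsf{L}_2$-structure that is a model of $\mathsf{RCA}_0$ and satisfies one of them satisfies all of them: \begin{enumerate} \item $\mathsf{ACA}_0$; \item $\Sigma^0_1\text{-}\mathsf{CE}$; \item $\Sigma^0_0\text{-}\mathsf{CE}$; \item $\mathsf{QF}\text{-}\mathsf{CE}$. \end{enumerate} -/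

import Mathlib

universe u

/-! # Second-order arithmetic: language, structures, and the theories under comparison

Variables are de Bruijn indices, separately for the two sorts: under a number quantifier the
number variable `0` is the bound one and the outer number variables are shifted by one, and
likewise for set quantifiers and set variables.  Free variables are parameters. -/

namespace SOA

/-! ## Syntax of the language `L₂` with signature `0, 1, +, ×, <, =, ∈` -/

/-- Number terms. -/
inductive Term where
  | var : ℕ → Term
  | zero : Term
  | one : Term
  | add : Term → Term → Term
  | mul : Term → Term → Term

instance : Zero Term := ⟨Term.zero⟩
instance : One Term := ⟨Term.one⟩
instance : Add Term := ⟨Term.add⟩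
instance : Mul Term := ⟨Term.mul⟩

/-- Formulas.  The second argument of `mem` is a set variable; equality of sets is not
a symbol of the language, it is defined by extensionality. -/
inductive Formula where
  | eq : Term → Term → Formula
  | lt : Term → Term → Formula
  | mem : Term → ℕ → Formula
  | neg : Formula → Formula
  | and : Formula → Formula → Formula
  | or : Formula → Formula → Formula
  | imp : Formula → Formula → Formula
  | allN : Formula → Formula
  | exN : Formula → Formula
  | allS : Formula → Formula
  | exS : Formula → Formula

infix:50 " ≐ " => Formula.eq
infix:50 " ≺ " => Formula.lt
infixr:35 " ⋏ " => Formula.and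
infixr:30 " ⋎ " => Formula.or
infixr:25 " ⇒ " => Formula.imp

/-- The biconditional. -/
def Formula.iff (φ ψ : Formula) : Formula := (φ ⇒ ψ) ⋏ (ψ ⇒ φ)

infix:20 " ⇔ " => Formula.iff

/-- Extend an assignment of variables by a value for the variable `0`. -/
def extend {α : Type*} (a : α) (v : ℕ → α) : ℕ → α
  | 0 => a
  | n + 1 => v n

/-! ## Substitution of terms for number variables and of set variables for set variables -/

/-- Simultaneous substitution in terms. -/
def Term.subst (σ : ℕ → Term) : Term → Term
  | .var n => σ n
  | .zero => .zero
  | .one => .one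
  | .add s t => .add (s.subst σ) (t.subst σ)
  | .mul s t => .mul (s.subst σ) (t.subst σ)

/-- The term `t` moved under `k` number quantifiers. -/
def Term.lift (k : ℕ) (t : Term) : Term := t.subst fun n => .var (n + k)

/-- Capture-avoiding simultaneous substitution: `σ` acts on the free number variables and
`ρ` on the free set variables. -/
def Formula.subst : (ℕ → Term) → (ℕ → ℕ) → Formula → Formula
  | σ, _, .eq s t => .eq (s.subst σ) (t.subst σ)
  | σ, _, .lt s t => .lt (s.subst σ) (t.subst σ)
  | σ, ρ, .mem t X => .mem (t.subst σ) (ρ X)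
  | σ, ρ, .neg φ => .neg (φ.subst σ ρ)
  | σ, ρ, .and φ ψ => .and (φ.subst σ ρ) (ψ.subst σ ρ)
  | σ, ρ, .or φ ψ => .or (φ.subst σ ρ) (ψ.subst σ ρ)
  | σ, ρ, .imp φ ψ => .imp (φ.subst σ ρ) (ψ.subst σ ρ)
  | σ, ρ, .allN φ => .allN (φ.subst (extend (.var 0) fun n => (σ n).lift 1) ρ)
  | σ, ρ, .exN φ => .exN (φ.subst (extend (.var 0) fun n => (σ n).lift 1) ρ)
  | σ, ρ, .allS φ => .allS (φ.subst σ (extend 0 fun X => ρ X + 1))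
  | σ, ρ, .exS φ => .exS (φ.subst σ (extend 0 fun X => ρ X + 1))

/-! ## Structures and satisfaction -/

/-- An `L₂`-structure: numbers with interpretations of the arithmetical symbols, and a
nonempty collection of sets of numbers. -/
structure L2Structure where
  Num : Type u
  [zero : Zero Num]
  [one : One Num]
  [add : Add Num]
  [mul : Mul Num]
  [lt : LT Num]
  sets : Set (Set Num)
  sets_nonempty : sets.Nonempty

attribute [instance] L2Structure.zero L2Structure.one L2Structure.add L2Structure.mul
  L2Structure.lt

/-- The value of a term. -/
def Term.eval {M : L2Structure.{u}} (v : ℕ → M.Num) : Term → M.Num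
  | .var n => v n
  | .zero => 0
  | .one => 1
  | .add s t => s.eval v + t.eval v
  | .mul s t => s.eval v * t.eval v

/-- Truth of a formula under an assignment; set quantifiers range over the sets of the
structure. -/
def Formula.Realize {M : L2Structure.{u}} : (ℕ → M.Num) → (ℕ → M.sets) → Formula → Prop
  | v, _, .eq s t => s.eval v = t.eval v
  | v, _, .lt s t => s.eval v < t.eval v
  | v, V, .mem t X => t.eval v ∈ (V X : Set M.Num)
  | v, V, .neg φ => ¬ φ.Realize v V
  | v, V, .and φ ψ => φ.Realize v V ∧ ψ.Realize v V
  | v, V, .or φ ψ => φ.Realize v V ∨ ψ.Realize v V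
  | v, V, .imp φ ψ => φ.Realize v V → ψ.Realize v V
  | v, V, .allN φ => ∀ a : M.Num, φ.Realize (extend a v) V
  | v, V, .exN φ => ∃ a : M.Num, φ.Realize (extend a v) V
  | v, V, .allS φ => ∀ X : M.sets, φ.Realize v (extend X V)
  | v, V, .exS φ => ∃ X : M.sets, φ.Realize v (extend X V)

/-- `M ⊨ T`: the universal closure of every formula of `T` is true in `M`. -/
def L2Structure.Models (M : L2Structure.{u}) (T : Set Formula) : Prop :=
  ∀ φ ∈ T, ∀ (v : ℕ → M.Num) (V : ℕ → M.sets), φ.Realize v V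

/-! ## Classes of formulas -/

/-- The bounded quantifier `(∀ n < t) φ`; the bound variable does not occur in `t`. -/
def Formula.ball (t : Term) (φ : Formula) : Formula := .allN (.var 0 ≺ t.lift 1 ⇒ φ)

/-- The bounded quantifier `(∃ n < t) φ`; the bound variable does not occur in `t`. -/
def Formula.bex (t : Term) (φ : Formula) : Formula := .exN (.var 0 ≺ t.lift 1 ⋏ φ)

/-- Formulas without quantifiers. -/
inductive Formula.IsQF : Formula → Prop
  | eq (s t : Term) : IsQF (s ≐ t)
  | lt (s t : Term) : IsQF (s ≺ t)
  | mem (t : Term) (X : ℕ) : IsQF (.mem t X)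
  | neg {φ : Formula} : IsQF φ → IsQF (.neg φ)
  | and {φ ψ : Formula} : IsQF φ → IsQF ψ → IsQF (φ ⋏ ψ)
  | or {φ ψ : Formula} : IsQF φ → IsQF ψ → IsQF (φ ⋎ ψ)
  | imp {φ ψ : Formula} : IsQF φ → IsQF ψ → IsQF (φ ⇒ ψ)

/-- `Σ⁰₀` formulas: all quantifiers are bounded number quantifiers. -/
inductive Formula.IsSigma00 : Formula → Prop
  | eq (s t : Term) : IsSigma00 (s ≐ t)
  | lt (s t : Term) : IsSigma00 (s ≺ t)
  | mem (t : Term) (X : ℕ) : IsSigma00 (.mem t X)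
  | neg {φ : Formula} : IsSigma00 φ → IsSigma00 (.neg φ)
  | and {φ ψ : Formula} : IsSigma00 φ → IsSigma00 ψ → IsSigma00 (φ ⋏ ψ)
  | or {φ ψ : Formula} : IsSigma00 φ → IsSigma00 ψ → IsSigma00 (φ ⋎ ψ)
  | imp {φ ψ : Formula} : IsSigma00 φ → IsSigma00 ψ → IsSigma00 (φ ⇒ ψ)
  | ball (t : Term) {φ : Formula} : IsSigma00 φ → IsSigma00 (.ball t φ)
  | bex (t : Term) {φ : Formula} : IsSigma00 φ → IsSigma00 (.bex t φ)

/-- `Σ⁰₁` formulas `∃ n θ` with `θ` in `Σ⁰₀`. -/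
def Formula.IsSigma01 (φ : Formula) : Prop := ∃ θ : Formula, θ.IsSigma00 ∧ φ = .exN θ

/-- `Π⁰₁` formulas `∀ n θ` with `θ` in `Σ⁰₀`. -/
def Formula.IsPi01 (φ : Formula) : Prop := ∃ θ : Formula, θ.IsSigma00 ∧ φ = .allN θ

/-- Arithmetical formulas: no set quantifiers (set parameters are allowed). -/
def Formula.IsArithmetical : Formula → Prop
  | .eq _ _ => True
  | .lt _ _ => True
  | .mem _ _ => True
  | .neg φ => φ.IsArithmetical
  | .and φ ψ => φ.IsArithmetical ∧ ψ.IsArithmetical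
  | .or φ ψ => φ.IsArithmetical ∧ ψ.IsArithmetical
  | .imp φ ψ => φ.IsArithmetical ∧ ψ.IsArithmetical
  | .allN φ => φ.IsArithmetical
  | .exN φ => φ.IsArithmetical
  | .allS _ => False
  | .exS _ => False

/-- All variables of the term are among the first `a`. -/
def Term.VarsBelow (a : ℕ) : Term → Prop
  | .var n => n < a
  | .zero => True
  | .one => True
  | .add s t => s.VarsBelow a ∧ t.VarsBelow a
  | .mul s t => s.VarsBelow a ∧ t.VarsBelow a

/-- All free number variables are among the first `a` and all free set variables among the
first `b`. -/
def Formula.FreeBelow : ℕ → ℕ → Formula → Prop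
  | a, _, .eq s t => s.VarsBelow a ∧ t.VarsBelow a
  | a, _, .lt s t => s.VarsBelow a ∧ t.VarsBelow a
  | a, b, .mem t X => t.VarsBelow a ∧ X < b
  | a, b, .neg φ => φ.FreeBelow a b
  | a, b, .and φ ψ => φ.FreeBelow a b ∧ ψ.FreeBelow a b
  | a, b, .or φ ψ => φ.FreeBelow a b ∧ ψ.FreeBelow a b
  | a, b, .imp φ ψ => φ.FreeBelow a b ∧ ψ.FreeBelow a b
  | a, b, .allN φ => φ.FreeBelow (a + 1) b
  | a, b, .exN φ => φ.FreeBelow (a + 1) b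
  | a, b, .allS φ => φ.FreeBelow a (b + 1)
  | a, b, .exS φ => φ.FreeBelow a (b + 1)

/-- The class `Σ⁰₀`, with arbitrary parameters. -/
def Sigma00 : Set Formula := {φ | φ.IsSigma00}

/-- The class `Σ⁰₁`, with arbitrary parameters. -/
def Sigma01 : Set Formula := {φ | φ.IsSigma01}

/-- The class `QF` of quantifier-free formulas `φ(X)` without parameters: the set variable `0`
is the only free variable. -/
def QF : Set Formula := {φ | φ.IsQF ∧ φ.FreeBelow 0 1}

/-! ## The theories `RCA₀` and `ACA₀` -/

/-- The axioms of a discrete ordered semiring. -/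
def discreteOrderedSemiring : Set Formula :=
  let x : Term := .var 0
  let y : Term := .var 1
  let z : Term := .var 2
  { (x + y) + z ≐ x + (y + z),
    x + y ≐ y + x,
    (x * y) * z ≐ x * (y * z),
    x * y ≐ y * x,
    x * (y + z) ≐ x * y + x * z,
    x + 0 ≐ x,
    x * 0 ≐ 0,
    x * 1 ≐ x,
    x ≺ y ⋏ y ≺ z ⇒ x ≺ z,
    .neg (x ≺ x),
    x ≺ y ⋎ x ≐ y ⋎ y ≺ x,
    x ≺ y ⇒ x + z ≺ y + z,
    0 ≺ z ⋏ x ≺ y ⇒ x * z ≺ y * z,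
    x ≺ y ⇒ .exN (x.lift 1 + .var 0 ≐ y.lift 1),
    0 ≺ 1,
    0 ≺ x ⇒ 1 ≺ x ⋎ 1 ≐ x,
    0 ≺ x ⋎ 0 ≐ x }

/-- Induction for `φ(n)`, where `n` is the number variable `0` of `φ`:
`φ(0) ∧ ∀ n (φ(n) → φ(n + 1)) → ∀ n φ(n)`. -/
def inductionAxiom (φ : Formula) : Formula :=
  (φ.subst (extend 0 Term.var) id) ⋏
    .allN (φ ⇒ φ.subst (extend (.var 0 + 1) fun n => .var (n + 1)) id)
    ⇒ .allN φ

/-- Comprehension for `φ(n)`, where `n` is the number variable `0` of `φ`: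
`∃ X ∀ n (n ∈ X ↔ φ(n))`, with `X` not occurring in `φ`. -/
def comprehensionAxiom (φ : Formula) : Formula :=
  .exS (.allN (.mem (.var 0) 0 ⇔ φ.subst .var fun X => X + 1))

/-- `RCA₀`: discrete ordered semiring, `Σ⁰₁` induction, `Δ⁰₁` comprehension. -/
def RCA0 : Set Formula :=
  discreteOrderedSemiring
    ∪ {χ | ∃ φ : Formula, φ.IsSigma01 ∧ χ = inductionAxiom φ}
    ∪ {χ | ∃ φ ψ : Formula, φ.IsSigma01 ∧ ψ.IsPi01 ∧
        χ = (.allN (φ ⇔ ψ) ⇒ comprehensionAxiom φ)}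

/-- `ACA₀`: `RCA₀` and comprehension for arithmetical formulas. -/
def ACA0 : Set Formula :=
  RCA0 ∪ {χ | ∃ φ : Formula, φ.IsArithmetical ∧ χ = comprehensionAxiom φ}

/-! ## Coding of pairs and of finite sets -/

/-- The pairing function `⟨s, t⟩ = (s + t)² + s`. -/
def Term.pair (s t : Term) : Term := (s + t) * (s + t) + s

/-- `s` divides `t`. -/
def divides (s t : Term) : Formula := .bex (t + 1) (s.lift 1 * .var 0 ≐ t.lift 1)

/-- `e` has the form `⟨k, ⟨m, n⟩⟩`. -/
def isTriple (e : Term) : Formula :=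
  .bex (e + 1) (.bex (e.lift 1 + 1) (.bex (e.lift 2 + 1)
    (e.lift 3 ≐ (Term.var 2).pair ((Term.var 1).pair (.var 0)))))

/-- `i ∈ D_e`: `e = ⟨k, ⟨m, n⟩⟩`, `i < k` and `m (i + 1) + 1` divides `n`. -/
def memCode (i e : Term) : Formula :=
  .bex (e + 1) (.bex (e.lift 1 + 1) (.bex (e.lift 2 + 1)
    (e.lift 3 ≐ (Term.var 2).pair ((Term.var 1).pair (.var 0)) ⋏
      i.lift 3 ≺ .var 2 ⋏
      divides (.var 1 * (i.lift 3 + 1) + 1) (.var 0))))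

/-- `e` is a canonical index: the least code `⟨k, ⟨m, n⟩⟩` of the finite set `D_e`. -/
def isCanonical (e : Term) : Formula :=
  isTriple e ⋏
    .ball e (isTriple (.var 0) ⇒
      .bex (e.lift 1) (.neg (memCode (.var 0) (e.lift 2) ⇔ memCode (.var 0) (.var 1))))

/-! ## The scheme `CE`

In this part `X`, `Y`, `D`, `A` stand for (indices of) set variables. -/

/-- `X ⊆ Y`. -/
def subsetF (X Y : ℕ) : Formula := .allN (.mem (.var 0) X ⇒ .mem (.var 0) Y)

/-- `X = ∅`. -/
def emptyF (X : ℕ) : Formula := .allN (.neg (.mem (.var 0) X))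

/-- `X` is finite: `∃ k ∀ i (i ∈ X → i < k)`. -/
def finiteF (X : ℕ) : Formula := .exN (.allN (.mem (.var 0) X ⇒ .var 0 ≺ .var 1))

/-- `D` is a finitary closure operator: each of its elements is a pair `⟨e, n⟩` with `e` a
canonical index. -/
def closureOperatorF (D : ℕ) : Formula :=
  .allN (.mem (.var 0) D ⇒
    .exN (.exN (isCanonical (.var 1) ⋏ .var 2 ≐ (Term.var 1).pair (.var 0))))

/-- `A` is `D`-closed: for all `⟨e, n⟩ ∈ D`, if `D_e ⊆ A` then `n ∈ A`. -/
def closedF (D A : ℕ) : Formula :=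
  .allN (.allN (.mem ((Term.var 1).pair (.var 0)) D ⇒
    .allN (memCode (.var 0) (.var 2) ⇒ .mem (.var 0) A) ⇒ .mem (.var 0) A))

/-- For a formula `φ(X)`, with `X` its set variable `0`, the formula `φ(Y)` placed under `d` set
quantifiers (so that the parameters of `φ` keep their meaning). -/
def Formula.at (φ : Formula) (Y d : ℕ) : Formula :=
  φ.subst .var (extend Y fun p => p + d)

/-- `φ(X)` is of finite character: `φ(∅)` holds and, for every set `A`, `φ(A)` holds if and only
if `φ(F)` holds for every finite `F ⊆ A`. -/
def finiteCharacter (φ : Formula) : Formula :=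
  .allS (emptyF 0 ⇒ φ.at 0 1) ⋏
  .allS (φ.at 0 1 ⇔ .allS (finiteF 0 ⋏ subsetF 0 1 ⇒ φ.at 0 2))

/-- The instance of `CE` for `φ(X)`: if `φ` is of finite character then, for all sets `D`, `A`,
`C` such that `D` is a finitary closure operator and `C` is a `D`-closed subset of `A` with
`φ(C)`, there is a set `B ⊇ C` that is maximal among the `D`-closed subsets of `A`
satisfying `φ`. -/
def ceAxiom (φ : Formula) : Formula :=
  finiteCharacter φ ⇒
  -- the set variables are now `C = 0`, `A = 1`, `D = 2`
  .allS (.allS (.allS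
    (closureOperatorF 2 ⋏ subsetF 0 1 ⋏ closedF 2 0 ⋏ φ.at 0 3 ⇒
      -- the set variables are now `B = 0`, `C = 1`, `A = 2`, `D = 3`
      .exS (subsetF 1 0 ⋏ subsetF 0 2 ⋏ closedF 3 0 ⋏ φ.at 0 4 ⋏
        -- the set variables are now `E = 0`, `B = 1`, `C = 2`, `A = 3`, `D = 4`
        .allS (subsetF 1 0 ⋏ subsetF 0 3 ⋏ closedF 4 0 ⋏ φ.at 0 5 ⇒ subsetF 0 1)))))

/-- The scheme `Γ`-`CE`. -/
def CE (Γ : Set Formula) : Set Formula := {χ | ∃ φ ∈ Γ, χ = ceAxiom φ}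

/-! ## The formulas above mean what they should -/

section Meaning

variable {M : L2Structure.{u}} (v : ℕ → M.Num) (V : ℕ → M.sets)

@[simp] theorem extend_zero {α : Type*} (a : α) (w : ℕ → α) : extend a w 0 = a := rfl

@[simp] theorem extend_succ {α : Type*} (a : α) (w : ℕ → α) (n : ℕ) :
    extend a w (n + 1) = w n := rfl

theorem eval_subst (σ : ℕ → Term) (t : Term) :
    (t.subst σ).eval v = t.eval fun n => (σ n).eval v := by
  induction t with
  | var n => rfl
  | zero => rfl
  | one => rfl
  | add s t hs ht => simp only [Term.subst, Term.eval, hs, ht]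
  | mul s t hs ht => simp only [Term.subst, Term.eval, hs, ht]

theorem realize_subst (φ : Formula) (σ : ℕ → Term) (ρ : ℕ → ℕ) :
    (φ.subst σ ρ).Realize v V ↔
      φ.Realize (fun n => (σ n).eval v) (fun X => V (ρ X)) := by
  have key : ∀ (σ : ℕ → Term) (w : ℕ → M.Num) (a : M.Num),
      (fun n => (extend (Term.var 0) (fun n => (σ n).lift 1) n).eval (extend a w)) =
        extend a fun n => (σ n).eval w := by
    intro σ w a
    funext n
    cases n with
    | zero => rfl
    | succ n => simp only [extend_succ, Term.lift, eval_subst, Term.eval]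
  have keyS : ∀ (ρ : ℕ → ℕ) (W : ℕ → M.sets) (A : M.sets),
      (fun X => extend A W (extend 0 (fun X => ρ X + 1) X)) =
        extend A fun X => W (ρ X) := by
    intro ρ W A
    funext X
    cases X <;> rfl
  induction φ generalizing v V σ ρ with
  | eq s t => simp only [Formula.subst, Formula.Realize, eval_subst]
  | lt s t => simp only [Formula.subst, Formula.Realize, eval_subst]
  | mem t X => simp only [Formula.subst, Formula.Realize, eval_subst]
  | neg φ ih => simp only [Formula.subst, Formula.Realize, ih]
  | and φ ψ ih₁ ih₂ => simp only [Formula.subst, Formula.Realize, ih₁, ih₂]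
  | or φ ψ ih₁ ih₂ => simp only [Formula.subst, Formula.Realize, ih₁, ih₂]
  | imp φ ψ ih₁ ih₂ => simp only [Formula.subst, Formula.Realize, ih₁, ih₂]
  | allN φ ih => simp only [Formula.subst, Formula.Realize, ih, key]
  | exN φ ih => simp only [Formula.subst, Formula.Realize, ih, key]
  | allS φ ih => simp only [Formula.subst, Formula.Realize, ih, keyS]
  | exS φ ih => simp only [Formula.subst, Formula.Realize, ih, keyS]

theorem eval_lift_one (t : Term) (a : M.Num) : (t.lift 1).eval (extend a v) = t.eval v := by
  simp only [Term.lift, eval_subst, Term.eval, extend_succ]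

theorem eval_lift_two (t : Term) (a b : M.Num) :
    (t.lift 2).eval (extend b (extend a v)) = t.eval v := by
  simp only [Term.lift, eval_subst]; rfl

theorem eval_lift_three (t : Term) (a b c : M.Num) :
    (t.lift 3).eval (extend c (extend b (extend a v))) = t.eval v := by
  simp only [Term.lift, eval_subst]; rfl

theorem realize_bex (t : Term) (φ : Formula) :
    (Formula.bex t φ).Realize v V ↔ ∃ a, a < t.eval v ∧ φ.Realize (extend a v) V := by
  simp only [Formula.bex, Formula.Realize, eval_lift_one]; rfl

theorem realize_ball (t : Term) (φ : Formula) :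
    (Formula.ball t φ).Realize v V ↔ ∀ a, a < t.eval v → φ.Realize (extend a v) V := by
  simp only [Formula.ball, Formula.Realize, eval_lift_one]; rfl

/-- The pairing function of a structure. -/
def L2Structure.pair (M : L2Structure.{u}) (a b : M.Num) : M.Num := (a + b) * (a + b) + a

/-- `i ∈ D_e` in a structure. -/
def L2Structure.MemCode (M : L2Structure.{u}) (i e : M.Num) : Prop :=
  ∃ k, k < e + 1 ∧ ∃ m, m < e + 1 ∧ ∃ n, n < e + 1 ∧
    e = M.pair k (M.pair m n) ∧ i < k ∧ ∃ q, q < n + 1 ∧ (m * (i + 1) + 1) * q = n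

/-- Being a code of a triple, in a structure. -/
def L2Structure.IsTriple (M : L2Structure.{u}) (e : M.Num) : Prop :=
  ∃ k, k < e + 1 ∧ ∃ m, m < e + 1 ∧ ∃ n, n < e + 1 ∧ e = M.pair k (M.pair m n)

/-- Being a canonical index, in a structure. -/
def L2Structure.IsCanonical (M : L2Structure.{u}) (e : M.Num) : Prop :=
  M.IsTriple e ∧ ∀ e', e' < e → M.IsTriple e' →
    ∃ i, i < e ∧ ¬ (M.MemCode i e ↔ M.MemCode i e')

/-- Being a finitary closure operator, in a structure. -/
def L2Structure.IsClosureOperator (M : L2Structure.{u}) (D : Set M.Num) : Prop :=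
  ∀ z ∈ D, ∃ e n, M.IsCanonical e ∧ z = M.pair e n

/-- Being closed under an operator, in a structure. -/
def L2Structure.IsClosed (M : L2Structure.{u}) (D A : Set M.Num) : Prop :=
  ∀ e n, M.pair e n ∈ D → (∀ i, M.MemCode i e → i ∈ A) → n ∈ A

@[simp] theorem eval_var (n : ℕ) : (Term.var n).eval v = v n := rfl

@[simp] theorem eval_one : (1 : Term).eval v = 1 := rfl

@[simp] theorem eval_add (s t : Term) : (s + t).eval v = s.eval v + t.eval v := rfl

@[simp] theorem eval_mul (s t : Term) : (s * t).eval v = s.eval v * t.eval v := rfl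

@[simp] theorem eval_pair (s t : Term) :
    (s.pair t).eval v = M.pair (s.eval v) (t.eval v) := rfl

theorem realize_isTriple (e : Term) :
    (isTriple e).Realize v V ↔ M.IsTriple (e.eval v) := by
  simp only [isTriple, realize_bex, Formula.Realize, eval_lift_one, eval_lift_two,
    eval_lift_three, eval_add, eval_one, eval_pair, eval_var]
  rfl

theorem realize_divides (s t : Term) :
    (divides s t).Realize v V ↔ ∃ q, q < t.eval v + 1 ∧ s.eval v * q = t.eval v := by
  simp only [divides, realize_bex, Formula.Realize, eval_lift_one, eval_add, eval_mul,
    eval_one, eval_var, extend_zero]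

theorem realize_memCode (i e : Term) :
    (memCode i e).Realize v V ↔ M.MemCode (i.eval v) (e.eval v) := by
  simp only [memCode, realize_bex, Formula.Realize, realize_divides, eval_lift_one,
    eval_lift_two, eval_lift_three, eval_add, eval_mul, eval_one, eval_pair, eval_var]
  rfl

theorem realize_isCanonical (e : Term) :
    (isCanonical e).Realize v V ↔ M.IsCanonical (e.eval v) := by
  simp only [isCanonical, Formula.iff, realize_ball, realize_bex, Formula.Realize,
    realize_isTriple, realize_memCode, eval_lift_one, eval_lift_two, eval_var,
    ← iff_iff_implies_and_implies]
  rfl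

theorem realize_closureOperatorF (D : ℕ) :
    (closureOperatorF D).Realize v V ↔ M.IsClosureOperator (V D) := by
  simp only [closureOperatorF, Formula.Realize, realize_isCanonical, eval_pair, eval_var]
  rfl

theorem realize_closedF (D A : ℕ) :
    (closedF D A).Realize v V ↔ M.IsClosed (V D) (V A) := by
  simp only [closedF, Formula.Realize, realize_memCode, eval_pair, eval_var]
  rfl

theorem realize_subsetF (X Y : ℕ) :
    (subsetF X Y).Realize v V ↔ (V X : Set M.Num) ⊆ V Y := Iff.rfl

theorem realize_finiteF (X : ℕ) :
    (finiteF X).Realize v V ↔ ∃ k, ∀ i ∈ (V X : Set M.Num), i < k := Iff.rfl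

theorem realize_emptyF (X : ℕ) : (emptyF X).Realize v V ↔ (V X : Set M.Num) = ∅ :=
  Set.eq_empty_iff_forall_notMem.symm

theorem realize_at (φ : Formula) (Y d : ℕ) :
    (φ.at Y d).Realize v V ↔ φ.Realize v (extend (V Y) fun p => V (p + d)) := by
  rw [Formula.at, realize_subst]
  have h : (fun X => V (extend Y (fun p => p + d) X)) = extend (V Y) fun p => V (p + d) := by
    funext X
    cases X <;> rfl
  rw [h]
  rfl

/-- Finite character of a property of the sets of a structure. -/
def L2Structure.FiniteCharacter (M : L2Structure.{u}) (P : M.sets → Prop) : Prop :=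
  (∀ X : M.sets, (X : Set M.Num) = ∅ → P X) ∧
    ∀ A : M.sets, P A ↔
      ∀ F : M.sets, (∃ k, ∀ i ∈ (F : Set M.Num), i < k) ∧ (F : Set M.Num) ⊆ A → P F

theorem realize_finiteCharacter (φ : Formula) :
    (finiteCharacter φ).Realize v V ↔
      M.FiniteCharacter fun X => φ.Realize v (extend X V) := by
  simp only [finiteCharacter, Formula.iff, Formula.Realize, realize_emptyF, realize_finiteF,
    realize_subsetF, realize_at, ← iff_iff_implies_and_implies]
  rfl

theorem realize_ceAxiom (φ : Formula) :
    (ceAxiom φ).Realize v V ↔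
      (M.FiniteCharacter (fun X => φ.Realize v (extend X V)) →
        ∀ D A C : M.sets, M.IsClosureOperator D ∧ (C : Set M.Num) ⊆ A ∧ M.IsClosed D C ∧
            φ.Realize v (extend C V) →
          ∃ B : M.sets, (C : Set M.Num) ⊆ B ∧ (B : Set M.Num) ⊆ A ∧ M.IsClosed D B ∧
            φ.Realize v (extend B V) ∧
            ∀ E : M.sets, (B : Set M.Num) ⊆ E ∧ (E : Set M.Num) ⊆ A ∧ M.IsClosed D E ∧
              φ.Realize v (extend E V) → (E : Set M.Num) ⊆ B) := by
  simp only [ceAxiom, Formula.Realize, realize_finiteCharacter, realize_closureOperatorF,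
    realize_subsetF, realize_closedF, realize_at]
  rfl

theorem realize_inductionAxiom (φ : Formula) :
    (inductionAxiom φ).Realize v V ↔
      (φ.Realize (extend 0 v) V ∧
          (∀ n, φ.Realize (extend n v) V → φ.Realize (extend (n + 1) v) V) →
        ∀ n, φ.Realize (extend n v) V) := by
  have h₀ : (fun n => (extend (0 : Term) Term.var n).eval v) = extend 0 v := by
    funext n
    cases n <;> rfl
  have h₁ : ∀ a, (fun n => (extend (Term.var 0 + 1) (fun n => Term.var (n + 1)) n).eval
      (extend a v)) = extend (a + 1) v := by
    intro a
    funext n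
    cases n <;> rfl
  simp only [inductionAxiom, Formula.Realize, realize_subst, h₀, h₁, id]

theorem realize_comprehensionAxiom (φ : Formula) :
    (comprehensionAxiom φ).Realize v V ↔
      ∃ X : M.sets, ∀ n, n ∈ (X : Set M.Num) ↔ φ.Realize (extend n v) V := by
  simp only [comprehensionAxiom, Formula.iff, Formula.Realize, realize_subst,
    ← iff_iff_implies_and_implies]
  rfl

end Meaning

end SOA

/-!
For a model `M` of `RCA₀` the theorem is proved semantically, for properties of numbers that are
definable by bounded formulas with parameters (`BddDef`).  Such properties define sets of `M`, and
every bounded set of `M` is some `D_e` (`exists_code`): the moduli `m (i + 1) + 1` are pairwise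
coprime when `m` is a suitable common multiple.

Comprehension for `Σ⁰₁` properties (`L2Structure.Sigma01Comp`) is equivalent to `ACA₀`.  By pairing,
the tuples that satisfy `∃ x, P x v` form a set, so bounded definability with set parameters absorbs
number quantifiers (`BddDef.ex`), and every arithmetical formula defines a set.

From `ACA₀` to `CE` (`exists_maximal_closed`): the closure of `C ∪ D_e` is arithmetically definable,
by codes of finite sets, uniformly in `e`.  Therefore it is decidable in `M` whether `D_e` is
contained in a `D`-closed set between `C` and `A` that satisfies `φ`; for `φ` of finite character
this is to say that the closure itself is such a set.  Going through the numbers in order and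
keeping each `x` that leaves this possible gives a set `B` (`exists_greedy`), all of whose initial
segments are contained in suitable closed sets.  As membership in `D_e`, derivations and `φ` only
involve bounded sets at a time, `B` is itself closed and satisfies `φ`, and it is maximal because
everything that could be added was kept.

From `QF`-`CE` to `ACA₀` (`sigma01Comp_of_models_CE_QF`): let `R` be bounded definable, let `A` be
the set of all `⟨n, s⟩` with `¬ R n s`, and let `D` derive every `⟨n, s⟩` from `⟨n, 0⟩`.  A closed
subset of `A` can contain `⟨n, 0⟩` only if no `s` satisfies `R n s`, and a maximal one contains
`⟨n, 0⟩` for all these `n`.  Here the formula of finite character can be any valid one.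
-/

namespace SOA

/-! ### Substitution and the formula classes -/

theorem Term.subst_subst (σ τ : ℕ → Term) (t : Term) :
    (t.subst σ).subst τ = t.subst fun n => (σ n).subst τ := by
  induction t with
  | var n => rfl
  | zero => rfl
  | one => rfl
  | add s t hs ht => simp only [Term.subst, hs, ht]
  | mul s t hs ht => simp only [Term.subst, hs, ht]

theorem Term.lift_one_subst (σ : ℕ → Term) (t : Term) :
    (t.lift 1).subst (extend (.var 0) fun n => (σ n).lift 1) = (t.subst σ).lift 1 := by
  simp only [Term.lift, Term.subst_subst, Term.subst, extend_succ]

theorem Formula.IsSigma00.subst {φ : Formula} (h : φ.IsSigma00) (σ : ℕ → Term) (ρ : ℕ → ℕ) :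
    (φ.subst σ ρ).IsSigma00 := by
  induction h generalizing σ with
  | eq s t => exact .eq _ _
  | lt s t => exact .lt _ _
  | mem t X => exact .mem _ _
  | neg _ ih => exact .neg (ih σ)
  | and _ _ ih₁ ih₂ => exact .and (ih₁ σ) (ih₂ σ)
  | or _ _ ih₁ ih₂ => exact .or (ih₁ σ) (ih₂ σ)
  | imp _ _ ih₁ ih₂ => exact .imp (ih₁ σ) (ih₂ σ)
  | ball t _ ih =>
    have := IsSigma00.ball (t.subst σ) (ih (extend (.var 0) fun n => (σ n).lift 1))
    rwa [Formula.ball, ← Term.lift_one_subst] at this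
  | bex t _ ih =>
    have := IsSigma00.bex (t.subst σ) (ih (extend (.var 0) fun n => (σ n).lift 1))
    rwa [Formula.bex, ← Term.lift_one_subst] at this

theorem Formula.IsSigma00.isArithmetical {φ : Formula} (h : φ.IsSigma00) :
    φ.IsArithmetical := by
  induction h with
  | eq s t => trivial
  | lt s t => trivial
  | mem t X => trivial
  | neg _ ih => exact ih
  | and _ _ ih₁ ih₂ => exact ⟨ih₁, ih₂⟩
  | or _ _ ih₁ ih₂ => exact ⟨ih₁, ih₂⟩
  | imp _ _ ih₁ ih₂ => exact ⟨ih₁, ih₂⟩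
  | ball t _ ih => exact ⟨trivial, ih⟩
  | bex t _ ih => exact ⟨trivial, ih⟩

theorem Formula.IsQF.isSigma00 {φ : Formula} (h : φ.IsQF) : φ.IsSigma00 := by
  induction h with
  | eq s t => exact .eq _ _
  | lt s t => exact .lt _ _
  | mem t X => exact .mem _ _
  | neg _ ih => exact .neg ih
  | and _ _ ih₁ ih₂ => exact .and ih₁ ih₂
  | or _ _ ih₁ ih₂ => exact .or ih₁ ih₂
  | imp _ _ ih₁ ih₂ => exact .imp ih₁ ih₂

/-- Prefixing a dummy existential quantifier turns a `Σ⁰₀` formula into a `Σ⁰₁` formula. -/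
theorem Formula.IsSigma00.exists_sigma01 (M : L2Structure.{u}) {φ : Formula}
    (hφ : φ.IsSigma00) :
    ∃ ψ : Formula, ψ.IsSigma01 ∧
      ∀ (v : ℕ → M.Num) (V : ℕ → M.sets), ψ.Realize v V ↔ φ.Realize v V := by
  refine ⟨.exN (φ.subst (fun n => .var (n + 1)) id), ⟨_, hφ.subst _ _, rfl⟩, fun v V => ?_⟩
  simp only [Formula.Realize, realize_subst]
  exact ⟨fun ⟨_, h⟩ => h, fun h => ⟨0, h⟩⟩

/-! ### The numbers of a model of `RCA₀` as an ordered semiring -/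

/-- `M` is a model of `RCA₀`. -/
class IsRCA (M : L2Structure.{u}) : Prop where
  models : M.Models RCA0

section Semiring

variable {M : L2Structure.{u}} [hM : IsRCA M]

/-- The instance of an axiom of discrete ordered semirings for given values of its variables. -/
theorem realize_semiring_axiom {φ : Formula} (h : φ ∈ discreteOrderedSemiring) (a b c : M.Num) :
    φ.Realize (M := M) (extend a (extend b fun _ => c))
      fun _ => ⟨_, M.sets_nonempty.choose_spec⟩ :=
  hM.models φ (.inl (.inl h)) _ _

theorem num_add_comm (a b : M.Num) : a + b = b + a :=
  realize_semiring_axiom (φ := Term.var 0 + Term.var 1 ≐ Term.var 1 + Term.var 0)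
    (by simp [discreteOrderedSemiring]) a b b

theorem num_mul_comm (a b : M.Num) : a * b = b * a :=
  realize_semiring_axiom (φ := Term.var 0 * Term.var 1 ≐ Term.var 1 * Term.var 0)
    (by simp [discreteOrderedSemiring]) a b b

theorem num_add_zero (a : M.Num) : a + 0 = a :=
  realize_semiring_axiom (φ := Term.var 0 + 0 ≐ Term.var 0)
    (by simp [discreteOrderedSemiring]) a a a

theorem num_mul_zero (a : M.Num) : a * 0 = 0 :=
  realize_semiring_axiom (φ := Term.var 0 * 0 ≐ 0) (by simp [discreteOrderedSemiring]) a a a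

theorem num_mul_one (a : M.Num) : a * 1 = a :=
  realize_semiring_axiom (φ := Term.var 0 * 1 ≐ Term.var 0)
    (by simp [discreteOrderedSemiring]) a a a

theorem num_mul_add (a b c : M.Num) : a * (b + c) = a * b + a * c :=
  realize_semiring_axiom
    (φ := Term.var 0 * (Term.var 1 + Term.var 2) ≐
      Term.var 0 * Term.var 1 + Term.var 0 * Term.var 2)
    (by simp [discreteOrderedSemiring]) a b c

theorem num_add_assoc (a b c : M.Num) : a + b + c = a + (b + c) :=
  realize_semiring_axiom
    (φ := (Term.var 0 + Term.var 1) + Term.var 2 ≐ Term.var 0 + (Term.var 1 + Term.var 2))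
    (by simp [discreteOrderedSemiring]) a b c

theorem num_mul_assoc (a b c : M.Num) : a * b * c = a * (b * c) :=
  realize_semiring_axiom
    (φ := (Term.var 0 * Term.var 1) * Term.var 2 ≐ Term.var 0 * (Term.var 1 * Term.var 2))
    (by simp [discreteOrderedSemiring]) a b c

noncomputable instance instCommSemiringNum : CommSemiring M.Num where
  zero := 0
  one := 1
  add := (· + ·)
  mul := (· * ·)
  add_assoc := num_add_assoc
  add_comm := num_add_comm
  add_zero := num_add_zero
  zero_add a := (num_add_comm 0 a).trans (num_add_zero a)
  mul_assoc := num_mul_assoc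
  mul_comm := num_mul_comm
  mul_one := num_mul_one
  one_mul a := (num_mul_comm 1 a).trans (num_mul_one a)
  mul_zero := num_mul_zero
  zero_mul a := (num_mul_comm 0 a).trans (num_mul_zero a)
  left_distrib := num_mul_add
  right_distrib a b c := ((num_mul_comm _ _).trans (num_mul_add c a b)).trans
    (congr_arg₂ _ (num_mul_comm _ _) (num_mul_comm _ _))
  nsmul := nsmulRec

theorem num_lt_trans {a b c : M.Num} (h₁ : a < b) (h₂ : b < c) : a < c :=
  realize_semiring_axiom (φ := Term.var 0 ≺ Term.var 1 ⋏ Term.var 1 ≺ Term.var 2 ⇒ Term.var 0 ≺ Term.var 2)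
    (by simp [discreteOrderedSemiring]) a b c ⟨h₁, h₂⟩

theorem num_lt_irrefl (a : M.Num) : ¬ a < a :=
  realize_semiring_axiom (φ := Formula.neg (Term.var 0 ≺ Term.var 0)) (by simp [discreteOrderedSemiring]) a a a

theorem num_lt_trichotomy (a b : M.Num) : a < b ∨ a = b ∨ b < a :=
  realize_semiring_axiom (φ := Term.var 0 ≺ Term.var 1 ⋎ Term.var 0 ≐ Term.var 1 ⋎ Term.var 1 ≺ Term.var 0)
    (by simp [discreteOrderedSemiring]) a b b

open Classical in
noncomputable instance instLinearOrderNum : LinearOrder M.Num where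
  lt := (· < ·)
  le a b := a < b ∨ a = b
  le_refl a := .inr rfl
  le_trans := by
    rintro a b c (h₁ | rfl) (h₂ | rfl)
    exacts [.inl (num_lt_trans h₁ h₂), .inl h₁, .inl h₂, .inr rfl]
  le_antisymm := by
    rintro a b (h₁ | rfl) (h₂ | h₂)
    exacts [(num_lt_irrefl a (num_lt_trans h₁ h₂)).elim, h₂.symm, rfl, rfl]
  le_total a b := by
    rcases num_lt_trichotomy a b with h | h | h
    exacts [.inl (.inl h), .inl (.inr h), .inr (.inl h)]
  lt_iff_le_not_ge a b := by
    refine ⟨fun h => ⟨.inl h, ?_⟩, ?_⟩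
    · rintro (h' | rfl)
      exacts [num_lt_irrefl a (num_lt_trans h h'), num_lt_irrefl _ h]
    · rintro ⟨h | rfl, h'⟩
      exacts [h, (h' (.inr rfl)).elim]
  toDecidableLE := Classical.decRel _

theorem num_add_lt_add_right {a b : M.Num} (h : a < b) (c : M.Num) : a + c < b + c :=
  realize_semiring_axiom (φ := Term.var 0 ≺ Term.var 1 ⇒ Term.var 0 + Term.var 2 ≺ Term.var 1 + Term.var 2)
    (by simp [discreteOrderedSemiring]) a b c h

theorem num_mul_lt_mul_right {a b c : M.Num} (h : a < b) (hc : 0 < c) : a * c < b * c :=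
  realize_semiring_axiom
    (φ := 0 ≺ Term.var 2 ⋏ Term.var 0 ≺ Term.var 1 ⇒ Term.var 0 * Term.var 2 ≺ Term.var 1 * Term.var 2)
    (by simp [discreteOrderedSemiring]) a b c ⟨hc, h⟩

theorem num_zero_lt_one : (0 : M.Num) < 1 :=
  realize_semiring_axiom (φ := 0 ≺ 1) (by simp [discreteOrderedSemiring]) (0 : M.Num) 0 0

theorem num_zero_le (a : M.Num) : 0 ≤ a := by
  have : 0 < a ∨ 0 = a := realize_semiring_axiom (φ := 0 ≺ Term.var 0 ⋎ 0 ≐ Term.var 0)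
    (by simp [discreteOrderedSemiring]) a a a
  exact this

theorem one_le_of_pos {a : M.Num} (h : 0 < a) : 1 ≤ a := by
  have : 0 < a → 1 < a ∨ 1 = a :=
    realize_semiring_axiom (φ := 0 ≺ Term.var 0 ⇒ 1 ≺ Term.var 0 ⋎ 1 ≐ Term.var 0)
    (by simp [discreteOrderedSemiring]) a a a
  exact this h

theorem num_exists_add_of_lt {a b : M.Num} (h : a < b) : ∃ c, a + c = b :=
  realize_semiring_axiom
    (φ := Term.var 0 ≺ Term.var 1 ⇒ Formula.exN ((Term.var 0).lift 1 + Term.var 0 ≐ (Term.var 1).lift 1))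
    (by simp [discreteOrderedSemiring]) a b b h

instance : IsStrictOrderedRing M.Num where
  add_le_add_left := by
    rintro a b (h | rfl) c
    exacts [.inl (num_add_lt_add_right h c), le_rfl]
  le_of_add_le_add_left := by
    intro a b c h
    by_contra! h'
    have := num_add_lt_add_right h' a
    rw [add_comm c, add_comm b] at this
    exact absurd h (not_le.2 this)
  zero_le_one := .inl num_zero_lt_one
  exists_pair_ne := ⟨0, 1, num_zero_lt_one.ne⟩
  mul_lt_mul_of_pos_left := by
    intro a ha b c h
    have := num_mul_lt_mul_right h ha
    simpa [mul_comm] using this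
  mul_lt_mul_of_pos_right := fun a ha b c h => num_mul_lt_mul_right h ha

instance : CanonicallyOrderedAdd M.Num where
  exists_add_of_le := by
    rintro a b (h | rfl)
    · obtain ⟨c, hc⟩ := num_exists_add_of_lt h
      exact ⟨c, hc.symm⟩
    · exact ⟨0, (add_zero a).symm⟩
  le_self_add a b := by simpa using num_zero_le b
  le_add_self a b := by simpa using num_zero_le b

theorem num_add_one_le_iff {a b : M.Num} : a + 1 ≤ b ↔ a < b := by
  refine ⟨fun h => lt_of_lt_of_le (lt_add_of_pos_right a zero_lt_one) h, fun h => ?_⟩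
  obtain ⟨c, rfl⟩ := exists_add_of_le h.le
  have hc : 0 < c := by simpa using h
  simpa using one_le_of_pos hc

theorem num_lt_add_one_iff {a b : M.Num} : a < b + 1 ↔ a ≤ b := by
  rw [← num_add_one_le_iff, add_le_add_iff_right]

end Semiring

/-! ### Bounded definability -/

section Definability

variable {M : L2Structure.{u}}

/-- The functions of an assignment `v` given by a number term, where arbitrary numbers are allowed
as constants. -/
inductive TermFun : ((ℕ → M.Num) → M.Num) → Prop
  | var (n : ℕ) : TermFun fun v => v n
  | const (c : M.Num) : TermFun fun _ => c
  | add {f g} : TermFun f → TermFun g → TermFun fun v => f v + g v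
  | mul {f g} : TermFun f → TermFun g → TermFun fun v => f v * g v

/-- The properties of an assignment `v` that are defined by a `Σ⁰₀` formula with arbitrary number
and set parameters.  The body of a quantifier is a predicate of the bound value and of `v`; it is
required to be definable with the bound value as variable `0` and `v` shifted by one. -/
inductive BddDef : ((ℕ → M.Num) → Prop) → Prop
  | eq {f g} : TermFun f → TermFun g → BddDef fun v => f v = g v
  | lt {f g} : TermFun f → TermFun g → BddDef fun v => f v < g v
  | mem {f} {X : Set M.Num} : X ∈ M.sets → TermFun f → BddDef fun v => f v ∈ X
  | not {P} : BddDef P → BddDef fun v => ¬ P v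
  | and {P Q} : BddDef P → BddDef Q → BddDef fun v => P v ∧ Q v
  | bex {f} {P : M.Num → (ℕ → M.Num) → Prop} : TermFun f →
      BddDef (fun v => P (v 0) fun n => v (n + 1)) → BddDef fun v => ∃ a, a < f v ∧ P a v

namespace BddDef

variable {P Q : (ℕ → M.Num) → Prop}

theorem congr (h : BddDef P) (e : ∀ v, P v ↔ Q v) : BddDef Q :=
  (funext fun v => propext (e v) : P = Q) ▸ h

theorem or (hP : BddDef P) (hQ : BddDef Q) : BddDef fun v => P v ∨ Q v :=
  (hP.not.and hQ.not).not.congr fun v => by tauto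

theorem imp (hP : BddDef P) (hQ : BddDef Q) : BddDef fun v => P v → Q v :=
  (hP.and hQ.not).not.congr fun v => by tauto

theorem iff (hP : BddDef P) (hQ : BddDef Q) : BddDef fun v => (P v ↔ Q v) :=
  ((hP.imp hQ).and (hQ.imp hP)).congr fun v => by tauto

theorem ball {f} {P : M.Num → (ℕ → M.Num) → Prop} (hf : TermFun f)
    (h : BddDef fun v => P (v 0) fun n => v (n + 1)) :
    BddDef fun v => ∀ a, a < f v → P a v :=
  (bex (P := fun a v => ¬ P a v) hf h.not).not.congr fun v => by simp

end BddDef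

theorem TermFun.comp {f} (hf : TermFun (M := M) f) {g : ℕ → (ℕ → M.Num) → M.Num}
    (hg : ∀ i, TermFun (g i)) : TermFun fun v => f fun i => g i v := by
  induction hf with
  | var n => exact hg n
  | const c => exact .const c
  | add _ _ ih₁ ih₂ => exact .add ih₁ ih₂
  | mul _ _ ih₁ ih₂ => exact .mul ih₁ ih₂

/-- A substitution of term functions, moved under a number quantifier. -/
theorem TermFun.under {g : ℕ → (ℕ → M.Num) → M.Num} (hg : ∀ i, TermFun (g i)) (i : ℕ) :
    TermFun fun v => extend (v 0) (fun i => g i fun n => v (n + 1)) i := by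
  cases i with
  | zero => exact .var 0
  | succ i => exact (hg i).comp fun n => .var (n + 1)

theorem BddDef.comp {P} (hP : BddDef (M := M) P) {g : ℕ → (ℕ → M.Num) → M.Num}
    (hg : ∀ i, TermFun (g i)) : BddDef fun v => P fun i => g i v := by
  induction hP generalizing g with
  | eq h₁ h₂ => exact .eq (h₁.comp hg) (h₂.comp hg)
  | lt h₁ h₂ => exact .lt (h₁.comp hg) (h₂.comp hg)
  | mem hX h => exact .mem hX (h.comp hg)
  | not _ ih => exact .not (ih hg)
  | and _ _ ih₁ ih₂ => exact .and (ih₁ hg) (ih₂ hg)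
  | @bex f P hf _ ih =>
    exact .bex (P := fun a v => P a fun i => g i v) (hf.comp hg) (ih (TermFun.under hg))

theorem Term.termFun (t : Term) {g : ℕ → (ℕ → M.Num) → M.Num} (hg : ∀ i, TermFun (g i)) :
    TermFun fun w => t.eval fun i => g i w := by
  induction t with
  | var n => exact hg n
  | zero => exact .const 0
  | one => exact .const 1
  | add s t hs ht => exact .add hs ht
  | mul s t hs ht => exact .mul hs ht

/-- The sequence that alternates between two given ones. -/
def interleave {α : Type*} (v u : ℕ → α) : ℕ → α :=
  fun n => if n % 2 = 0 then v (n / 2) else u (n / 2)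

theorem interleave_even {α : Type*} (v u : ℕ → α) (n : ℕ) : interleave v u (2 * n) = v n := by
  simp [interleave]

theorem interleave_odd {α : Type*} (v u : ℕ → α) (n : ℕ) : interleave v u (2 * n + 1) = u n := by
  have h₁ : (2 * n + 1) % 2 = 1 := by omega
  have h₂ : (2 * n + 1) / 2 = n := by omega
  simp [interleave, h₁, h₂]

theorem apply_interleave {α β : Type*} (f : α → β) (v u : ℕ → α) (n : ℕ) :
    f (interleave v u n) = interleave (fun i => f (v i)) (fun i => f (u i)) n := by
  unfold interleave; split <;> rfl

/-- Renaming of variables that makes room for a second list of parameters. -/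
def leftVar : ℕ → ℕ := interleave (fun n => 2 * n) fun n => 2 * (2 * n) + 1

/-- The companion of `leftVar`, for the second list of parameters. -/
def rightVar : ℕ → ℕ := interleave (fun n => 2 * n) fun n => 2 * (2 * n + 1) + 1

theorem interleave_leftVar {α : Type*} (v u u' : ℕ → α) :
    (fun n => interleave v (interleave u u') (leftVar n)) = interleave v u := by
  funext n
  rw [leftVar, apply_interleave (interleave v (interleave u u'))]
  simp only [interleave_even, interleave_odd]

theorem interleave_rightVar {α : Type*} (v u u' : ℕ → α) :
    (fun n => interleave v (interleave u u') (rightVar n)) = interleave v u' := by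
  funext n
  rw [rightVar, apply_interleave (interleave v (interleave u u'))]
  simp only [interleave_even, interleave_odd]

theorem TermFun.exists_term {f} (hf : TermFun (M := M) f) :
    ∃ (t : Term) (u : ℕ → M.Num), ∀ v, t.eval (interleave v u) = f v := by
  induction hf with
  | var n => exact ⟨.var (2 * n), fun _ => 0, fun v => interleave_even _ _ _⟩
  | const c => exact ⟨.var (2 * 0 + 1), fun _ => c, fun v => interleave_odd _ _ _⟩
  | add _ _ ih₁ ih₂ =>
    obtain ⟨t₁, u₁, h₁⟩ := ih₁
    obtain ⟨t₂, u₂, h₂⟩ := ih₂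
    refine ⟨.add (t₁.subst fun n => .var (leftVar n)) (t₂.subst fun n => .var (rightVar n)),
      interleave u₁ u₂, fun v => ?_⟩
    simp only [Term.eval, eval_subst, interleave_leftVar, interleave_rightVar, h₁, h₂]
  | mul _ _ ih₁ ih₂ =>
    obtain ⟨t₁, u₁, h₁⟩ := ih₁
    obtain ⟨t₂, u₂, h₂⟩ := ih₂
    refine ⟨.mul (t₁.subst fun n => .var (leftVar n)) (t₂.subst fun n => .var (rightVar n)),
      interleave u₁ u₂, fun v => ?_⟩
    simp only [Term.eval, eval_subst, interleave_leftVar, interleave_rightVar, h₁, h₂]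

/-- Two term functions can be represented with the same list of parameters. -/
theorem TermFun.exists_term₂ {f g} (hf : TermFun (M := M) f) (hg : TermFun g) :
    ∃ (s t : Term) (u : ℕ → M.Num), ∀ v,
      s.eval (interleave v u) = f v ∧ t.eval (interleave v u) = g v := by
  obtain ⟨t₁, u₁, h₁⟩ := hf.exists_term
  obtain ⟨t₂, u₂, h₂⟩ := hg.exists_term
  refine ⟨t₁.subst fun n => .var (leftVar n), t₂.subst fun n => .var (rightVar n),
      interleave u₁ u₂, fun v => ?_⟩
  simp only [eval_subst, Term.eval, interleave_leftVar, interleave_rightVar, h₁, h₂, and_self]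

/-- A bounded definable property is defined by a `Σ⁰₀` formula; the even variables of the formula
stand for the assignment, the odd ones for the number parameters. -/
theorem BddDef.exists_formula {P} (hP : BddDef (M := M) P) :
    ∃ (θ : Formula) (u : ℕ → M.Num) (V : ℕ → M.sets),
      θ.IsSigma00 ∧ ∀ v, θ.Realize (interleave v u) V ↔ P v := by
  obtain ⟨X₀, hX₀⟩ := M.sets_nonempty
  induction hP with
  | eq hf hg =>
    obtain ⟨s, t, u, h⟩ := hf.exists_term₂ hg
    exact ⟨s ≐ t, u, fun _ => ⟨X₀, hX₀⟩, .eq _ _, fun v => by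
      simp only [Formula.Realize, (h v).1, (h v).2]⟩
  | lt hf hg =>
    obtain ⟨s, t, u, h⟩ := hf.exists_term₂ hg
    exact ⟨s ≺ t, u, fun _ => ⟨X₀, hX₀⟩, .lt _ _, fun v => by
      simp only [Formula.Realize, (h v).1, (h v).2]⟩
  | @mem f X hX hf =>
    obtain ⟨t, u, h⟩ := hf.exists_term
    exact ⟨.mem t 0, u, fun _ => ⟨X, hX⟩, .mem _ _, fun v => by
      simp only [Formula.Realize, h]⟩
  | not _ ih =>
    obtain ⟨θ, u, V, hθ, h⟩ := ih
    exact ⟨.neg θ, u, V, .neg hθ, fun v => by simp only [Formula.Realize, h]⟩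
  | and _ _ ih₁ ih₂ =>
    obtain ⟨θ₁, u₁, V₁, hθ₁, h₁⟩ := ih₁
    obtain ⟨θ₂, u₂, V₂, hθ₂, h₂⟩ := ih₂
    refine ⟨.and (θ₁.subst (fun n => .var (leftVar n)) fun X => 2 * X)
      (θ₂.subst (fun n => .var (rightVar n)) fun X => 2 * X + 1),
      interleave u₁ u₂, interleave V₁ V₂, .and (hθ₁.subst _ _) (hθ₂.subst _ _), fun v => ?_⟩
    simp only [Formula.Realize, realize_subst, eval_var, interleave_leftVar,
      interleave_rightVar, interleave_even, interleave_odd, h₁, h₂]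
  | @bex f P hf _ ih =>
    obtain ⟨t, u₁, h₁⟩ := hf.exists_term
    obtain ⟨θ, u₂, V, hθ, h₂⟩ := ih
    refine ⟨.bex (t.subst fun n => .var (leftVar n))
      (θ.subst (interleave (extend (.var 0) fun n => .var (2 * n + 1))
        fun n => .var (2 * (2 * n + 1) + 1 + 1)) id),
      interleave u₁ u₂, V, .bex _ (hθ.subst _ _), fun v => ?_⟩
    have key : ∀ a, (fun n => Term.eval (extend a (interleave v (interleave u₁ u₂)))
        (interleave (extend (.var 0) fun n => .var (2 * n + 1))
          (fun n => .var (2 * (2 * n + 1) + 1 + 1)) n)) = interleave (extend a v) u₂ := by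
      intro a
      funext n
      rw [apply_interleave (Term.eval _)]
      congr 1
      · funext i
        cases i with
        | zero => rfl
        | succ i => simp [interleave_even]
      · funext i
        simp [interleave_odd]
    simp only [realize_bex, eval_subst, eval_var, interleave_leftVar, h₁, realize_subst, key, id,
      h₂]
    rfl

end Definability

section Comprehension

variable {M : L2Structure.{u}}

/-- A `Σ⁰₁` property of a number is defined by a `Σ⁰₁` formula with parameters. -/
theorem BddDef.exists_formula₂ {R : M.Num → M.Num → Prop} (h : BddDef fun v => R (v 0) (v 1)) :
    ∃ (θ : Formula) (u : ℕ → M.Num) (V : ℕ → M.sets), θ.IsSigma00 ∧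
      ∀ n y, θ.Realize (extend y (extend n u)) V ↔ R n y := by
  obtain ⟨θ, u, V, hθ, h⟩ := h.exists_formula
  refine ⟨θ.subst (interleave (extend (.var 1) fun _ => .var 0) fun k => .var (k + 2)) id, u, V,
    hθ.subst _ _, fun n y => ?_⟩
  have key : (fun k => Term.eval (extend y (extend n u))
      (interleave (extend (.var 1) fun _ => .var 0) (fun k => .var (k + 2)) k)) =
      interleave (extend n fun _ => y) u := by
    funext k
    rw [apply_interleave (Term.eval _)]
    congr 1
    funext i
    cases i <;> rfl
  rw [realize_subst, key]
  exact h _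

/-- `Σ⁰₁` comprehension, for properties of numbers. -/
def L2Structure.Sigma01Comp (M : L2Structure.{u}) : Prop :=
  ∀ R : M.Num → M.Num → Prop, BddDef (fun v => R (v 0) (v 1)) → {n | ∃ y, R n y} ∈ M.sets

theorem sigma01Comp_of_models_ACA0 (h : M.Models ACA0) : M.Sigma01Comp := by
  intro R hR
  obtain ⟨θ, u, V, hθ, hR⟩ := hR.exists_formula₂
  have hφ : (Formula.exN θ).IsArithmetical := hθ.isArithmetical
  obtain ⟨X, hX⟩ := (realize_comprehensionAxiom u V _).1 (h _ (.inr ⟨_, hφ, rfl⟩) u V)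
  have : {n | ∃ y, R n y} = X := by
    ext n
    simp only [Set.mem_ofPred_eq, hX, Formula.Realize, hR]
  rw [this]
  exact X.2

variable [hM : IsRCA M]

/-- `Σ⁰₀` comprehension. -/
theorem BddDef.setOf_mem_sets {P : M.Num → Prop} (h : BddDef fun v => P (v 0)) :
    {n | P n} ∈ M.sets := by
  obtain ⟨θ, u, V, hθ, hP⟩ := BddDef.exists_formula₂ (R := fun n _ => P n) h
  have h₁ := hM.models _ (.inr ⟨.exN θ, .allN θ, ⟨θ, hθ, rfl⟩, ⟨θ, hθ, rfl⟩, rfl⟩) u V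
  rw [Formula.Realize, realize_comprehensionAxiom] at h₁
  obtain ⟨X, hX⟩ := h₁ (fun n => by
    simp only [Formula.iff, Formula.Realize, hP]
    exact ⟨fun ⟨_, h⟩ _ => h, fun h => ⟨0, h 0⟩⟩)
  have : {n | P n} = X := by
    ext n
    rw [hX]
    simp only [Set.mem_ofPred_eq, Formula.Realize, hP]
    exact ⟨fun h => ⟨0, h⟩, fun ⟨_, h⟩ => h⟩
  rw [this]
  exact X.2

theorem sigma01_induction {R : M.Num → M.Num → Prop} (hR : BddDef fun v => R (v 0) (v 1))
    (h₀ : ∃ y, R 0 y) (h₁ : ∀ n, (∃ y, R n y) → ∃ y, R (n + 1) y) (n : M.Num) : ∃ y, R n y := by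
  obtain ⟨θ, u, V, hθ, hR⟩ := hR.exists_formula₂
  have h := hM.models _ (.inl (.inr ⟨.exN θ, ⟨θ, hθ, rfl⟩, rfl⟩)) u V
  rw [realize_inductionAxiom] at h
  simp only [Formula.Realize, hR] at h
  exact h ⟨h₀, h₁⟩ n

theorem set_induction {P : M.Num → Prop} (hP : {n | P n} ∈ M.sets) (h₀ : P 0)
    (h₁ : ∀ n, P n → P (n + 1)) (n : M.Num) : P n :=
  (sigma01_induction (R := fun n _ => n ∈ {n | P n}) (.mem hP (.var 0)) ⟨0, h₀⟩
    (fun n ⟨_, h⟩ => ⟨0, h₁ n h⟩) n).choose_spec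

/-- The least number principle. -/
theorem exists_least {X : Set M.Num} (hX : X ∈ M.sets) (hne : X.Nonempty) :
    ∃ n ∈ X, ∀ m < n, m ∉ X := by
  by_contra! h
  have : ∀ n : M.Num, ∀ m, m < n → ¬ m ∈ X := by
    refine set_induction (BddDef.setOf_mem_sets ?_) (fun m hm => by simp at hm) ?_
    · exact .ball (P := fun m _ => ¬ m ∈ X) (.var 0) (.not (.mem hX (.var 0)))
    · intro n ih m hm hmX
      obtain ⟨l, hl, hlX⟩ := h m hmX
      exact ih l (hl.trans_le (num_lt_add_one_iff.1 hm)) hlX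
  obtain ⟨n, hn⟩ := hne
  exact this (n + 1) n (num_lt_add_one_iff.2 le_rfl) hn

end Comprehension

/-! ### Pairs and codes of finite sets -/

section Coding

variable {M : L2Structure.{u}}

theorem TermFun.pair {f g} (hf : TermFun (M := M) f) (hg : TermFun g) :
    TermFun fun v => M.pair (f v) (g v) :=
  .add (.mul (.add hf hg) (.add hf hg)) hf

theorem BddDef.memCode {f g} (hf : TermFun (M := M) f) (hg : TermFun g) :
    BddDef fun v => M.MemCode (f v) (g v) := by
  have h : BddDef fun w : ℕ → M.Num => M.MemCode (w 0) (w 1) := by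
    unfold L2Structure.MemCode
    repeat' first
      | apply BddDef.bex | apply BddDef.and | apply BddDef.eq | apply BddDef.lt
      | apply TermFun.var | apply TermFun.pair | apply TermFun.const | apply TermFun.add
      | apply TermFun.mul
  have hg' : ∀ i, TermFun (extend f (fun _ => g) i) := by
    rintro (_ | i)
    exacts [hf, hg]
  exact h.comp hg'

theorem BddDef.isTriple {f} (hf : TermFun (M := M) f) : BddDef fun v => M.IsTriple (f v) := by
  have h : BddDef fun w : ℕ → M.Num => M.IsTriple (w 0) := by
    unfold L2Structure.IsTriple
    repeat' first
      | apply BddDef.bex | apply BddDef.eq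
      | apply TermFun.var | apply TermFun.pair | apply TermFun.const | apply TermFun.add
  exact h.comp fun _ => hf

theorem BddDef.isCanonical {f} (hf : TermFun (M := M) f) :
    BddDef fun v => M.IsCanonical (f v) := by
  have h : BddDef fun w : ℕ → M.Num => M.IsCanonical (w 0) := by
    unfold L2Structure.IsCanonical
    repeat' first
      | apply BddDef.isTriple | apply BddDef.memCode | apply BddDef.not | apply BddDef.iff
      | apply BddDef.bex | apply BddDef.ball | apply BddDef.and | apply BddDef.imp
      | apply TermFun.var
  exact h.comp fun _ => hf

variable [hM : IsRCA M]

theorem num_add_one_pos (a : M.Num) : 0 < a + 1 := num_lt_add_one_iff.2 (num_zero_le a)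

theorem le_pair_left (a b : M.Num) : a ≤ M.pair a b := le_add_self

theorem num_le_mul_self (a : M.Num) : a ≤ a * a := by
  rcases eq_or_lt_of_le (num_zero_le a) with h | h
  · simp [← h]
  · exact le_mul_of_one_le_left h.le (one_le_of_pos h)

theorem le_pair_right (a b : M.Num) : b ≤ M.pair a b :=
  (le_add_self.trans (num_le_mul_self (a + b))).trans le_self_add

theorem pair_lt_of_add_lt {a b c d : M.Num} (h : a + b < c + d) : M.pair a b < M.pair c d := by
  have h₁ : a + b + 1 ≤ c + d := num_add_one_le_iff.2 h
  calc M.pair a b < (a + b + 1) * (a + b + 1) := by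
        have : (a + b + 1) * (a + b + 1) = M.pair a b + (b + (a + b) + 1) := by
          unfold L2Structure.pair; ring
        rw [this]
        exact lt_add_of_pos_right _ (num_add_one_pos _)
    _ ≤ (c + d) * (c + d) := mul_le_mul' h₁ h₁
    _ ≤ M.pair c d := le_self_add

theorem pair_inj {a b c d : M.Num} : M.pair a b = M.pair c d ↔ a = c ∧ b = d := by
  refine ⟨fun h => ?_, by rintro ⟨rfl, rfl⟩; rfl⟩
  have hs : a + b = c + d := by
    rcases lt_trichotomy (a + b) (c + d) with h' | h' | h'
    exacts [((pair_lt_of_add_lt h').ne h).elim, h', ((pair_lt_of_add_lt h').ne' h).elim]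
  have hac : a = c := by
    unfold L2Structure.pair at h
    rw [hs] at h
    exact add_left_cancel h
  subst hac
  exact ⟨rfl, add_left_cancel hs⟩

/-- Divisibility with a bounded witness. -/
theorem exists_lt_mul_eq_iff_dvd {d n : M.Num} (hd : 0 < d) :
    (∃ q, q < n + 1 ∧ d * q = n) ↔ d ∣ n := by
  refine ⟨fun ⟨q, _, h⟩ => ⟨q, h.symm⟩, fun ⟨q, h⟩ => ⟨q, ?_, h.symm⟩⟩
  rw [num_lt_add_one_iff, h]
  exact le_mul_of_one_le_left (num_zero_le q) (one_le_of_pos hd)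

theorem isTriple_pair (k m n : M.Num) : M.IsTriple (M.pair k (M.pair m n)) :=
  ⟨k, num_lt_add_one_iff.2 (le_pair_left _ _),
    m, num_lt_add_one_iff.2 ((le_pair_left _ _).trans (le_pair_right _ _)),
    n, num_lt_add_one_iff.2 ((le_pair_right _ _).trans (le_pair_right _ _)), rfl⟩

theorem memCode_pair {i k m n : M.Num} :
    M.MemCode i (M.pair k (M.pair m n)) ↔ i < k ∧ m * (i + 1) + 1 ∣ n := by
  constructor
  · rintro ⟨k', -, m', -, n', -, h, hi, h'⟩
    obtain ⟨hk, h⟩ := pair_inj.1 h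
    obtain ⟨hm, hn⟩ := pair_inj.1 h
    subst hk hm hn
    exact ⟨hi, (exists_lt_mul_eq_iff_dvd (num_add_one_pos _)).1 h'⟩
  · rintro ⟨hi, h⟩
    exact ⟨k, num_lt_add_one_iff.2 (le_pair_left _ _),
      m, num_lt_add_one_iff.2 ((le_pair_left _ _).trans (le_pair_right _ _)),
      n, num_lt_add_one_iff.2 ((le_pair_right _ _).trans (le_pair_right _ _)), rfl, hi,
      (exists_lt_mul_eq_iff_dvd (num_add_one_pos _)).2 h⟩

/-- The elements of a coded set are less than its code. -/
theorem lt_of_memCode {i e : M.Num} (h : M.MemCode i e) : i < e := by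
  obtain ⟨k, -, m, -, n, -, rfl, hi, -⟩ := h
  exact hi.trans_le (le_pair_left _ _)

theorem exists_common_multiple (k : M.Num) :
    ∃ m : M.Num, 0 < m ∧ ∀ i < k, i + 1 ∣ m := by
  have key := sigma01_induction
    (R := fun k m : M.Num => 0 < m ∧ ∀ i, i < k → ∃ q, q < m + 1 ∧ (i + 1) * q = m) ?_
    ⟨1, zero_lt_one, fun i hi => absurd hi (not_lt.2 (num_zero_le i))⟩ ?_ k
  · simpa only [exists_lt_mul_eq_iff_dvd (num_add_one_pos _)] using key
  · repeat' first
      | apply BddDef.bex | apply BddDef.ball | apply BddDef.and | apply BddDef.eq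
      | apply BddDef.lt | apply TermFun.var | apply TermFun.const | apply TermFun.add
      | apply TermFun.mul
  · simp only [exists_lt_mul_eq_iff_dvd (num_add_one_pos _)]
    rintro k ⟨m, hm, h⟩
    refine ⟨m * (k + 1), mul_pos hm (num_add_one_pos k), fun i hi => ?_⟩
    rcases (num_lt_add_one_iff.1 hi).lt_or_eq with hi | rfl
    exacts [(h i hi).mul_right _, dvd_mul_left _ _]

theorem dvd_of_dvd_add {d a b : M.Num} (ha : d ∣ a) (h : d ∣ a + b) : d ∣ b := by
  obtain ⟨p, rfl⟩ := ha
  obtain ⟨q, hq⟩ := h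
  rcases eq_or_lt_of_le (num_zero_le d) with rfl | hd
  · exact ⟨q, by simpa using hq⟩
  have hpq : p ≤ q := by
    refine le_of_mul_le_mul_left ?_ hd
    rw [← hq]
    exact le_self_add
  obtain ⟨r, rfl⟩ := exists_add_of_le hpq
  refine ⟨r, ?_⟩
  rw [mul_add] at hq
  exact add_left_cancel hq

/-- If `c` divides `m`, then `m a + 1` is prime to `c`. -/
theorem dvd_of_dvd_mul_of_dvd {m c a n : M.Num} (hc : c ∣ m) (h : m * a + 1 ∣ n * c) :
    m * a + 1 ∣ n := by
  obtain ⟨r, hr⟩ := hc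
  have h₁ : m * a + 1 ∣ n * c * (r * a) := h.mul_right _
  have h₂ : m * a + 1 ∣ n * c * (r * a) + n := by
    refine ⟨n, ?_⟩
    rw [hr]; ring
  exact dvd_of_dvd_add h₁ h₂

/-- The moduli `m (i + 1) + 1` for `i < k` are pairwise coprime when all positive numbers up to
`k` divide `m`. -/
theorem dvd_of_dvd_mul_modulus {k m i j n : M.Num} (hm : ∀ i < k, i + 1 ∣ m) (hi : i < k)
    (hj : j < k) (hij : i ≠ j) (h : m * (i + 1) + 1 ∣ n * (m * (j + 1) + 1)) :
    m * (i + 1) + 1 ∣ n := by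
  -- `(i + 1) (m (j + 1) + 1)` and `(j + 1) (m (i + 1) + 1)` differ by `|i - j|`, a divisor of `m`.
  have h' : m * (i + 1) + 1 ∣ n * (m * (j + 1) + 1) * (i + 1) := h.mul_right _
  have hmul : m * (i + 1) + 1 ∣ n * ((m * (i + 1) + 1) * (j + 1)) :=
    ((dvd_refl _).mul_right _).mul_left _
  rcases lt_or_gt_of_ne hij with hlt | hlt
  · obtain ⟨c, rfl⟩ := exists_add_of_le (num_add_one_le_iff.2 hlt)
    have e : n * ((m * (i + 1) + 1) * (i + 1 + c + 1)) =
        n * (m * (i + 1 + c + 1) + 1) * (i + 1) + n * (c + 1) := by ring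
    have hc : c + 1 ∣ m := hm c (lt_of_le_of_lt le_add_self hj)
    exact dvd_of_dvd_mul_of_dvd hc (dvd_of_dvd_add h' (e ▸ hmul))
  · obtain ⟨c, rfl⟩ := exists_add_of_le (num_add_one_le_iff.2 hlt)
    have e : n * (m * (j + 1) + 1) * (j + 1 + c + 1) =
        n * ((m * (j + 1 + c + 1) + 1) * (j + 1)) + n * (c + 1) := by ring
    have hc : c + 1 ∣ m := hm c (lt_of_le_of_lt le_add_self hi)
    exact dvd_of_dvd_mul_of_dvd hc (dvd_of_dvd_add hmul (e ▸ h'))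

/-- Every bounded set is coded. -/
theorem exists_code {X : Set M.Num} (hX : X ∈ M.sets) {k : M.Num} (hk : ∀ i ∈ X, i < k) :
    ∃ e, M.IsTriple e ∧ ∀ i, M.MemCode i e ↔ i ∈ X := by
  obtain ⟨m, hm0, hm⟩ := exists_common_multiple k
  have key := sigma01_induction
    (R := fun j n : M.Num => ∀ i, i < k →
      ((∃ q, q < n + 1 ∧ (m * (i + 1) + 1) * q = n) ↔ i ∈ X ∧ i < j)) ?_ ⟨1, ?_⟩ ?_ k
  · simp only [exists_lt_mul_eq_iff_dvd (num_add_one_pos _)] at key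
    obtain ⟨n, hn⟩ := key
    refine ⟨M.pair k (M.pair m n), isTriple_pair _ _ _, fun i => ?_⟩
    rw [memCode_pair]
    exact ⟨fun ⟨hi, h⟩ => ((hn i hi).1 h).1, fun hi => ⟨hk i hi, (hn i (hk i hi)).2 ⟨hi, hk i hi⟩⟩⟩
  · repeat' first
      | apply BddDef.iff | apply BddDef.bex | apply BddDef.ball | apply BddDef.and
      | apply BddDef.eq | apply BddDef.lt | exact BddDef.mem hX (.var _) | apply TermFun.var
      | apply TermFun.const | apply TermFun.add | apply TermFun.mul
  · intro i hi
    rw [exists_lt_mul_eq_iff_dvd (num_add_one_pos _)]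
    refine ⟨fun ⟨q, hq⟩ => ?_, fun h => absurd h.2 (not_lt.2 (num_zero_le i))⟩
    have hlt : 1 < m * (i + 1) + 1 := lt_add_of_pos_left 1 (mul_pos hm0 (num_add_one_pos i))
    have hq0 : q ≠ 0 := by rintro rfl; simp at hq
    have : m * (i + 1) + 1 ≤ 1 := by
      conv_rhs => rw [hq]
      exact le_mul_of_one_le_right (num_zero_le _)
        (one_le_of_pos (lt_of_le_of_ne (num_zero_le q) hq0.symm))
    exact absurd hlt (not_lt.2 this)
  · simp only [exists_lt_mul_eq_iff_dvd (num_add_one_pos _)]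
    rintro j ⟨n, hn⟩
    by_cases hj : j ∈ X
    · refine ⟨n * (m * (j + 1) + 1), fun i hi => ?_⟩
      by_cases hij : i = j
      · subst hij
        exact ⟨fun _ => ⟨hj, num_lt_add_one_iff.2 le_rfl⟩, fun _ => dvd_mul_left _ _⟩
      · refine ⟨fun h => ?_, fun ⟨h₁, h₂⟩ => ?_⟩
        · have := (hn i hi).1 (dvd_of_dvd_mul_modulus hm hi (hk j hj) hij h)
          exact ⟨this.1, this.2.trans (num_lt_add_one_iff.2 le_rfl)⟩
        · exact ((hn i hi).2 ⟨h₁, lt_of_le_of_ne (num_lt_add_one_iff.1 h₂) hij⟩).mul_right _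
    · refine ⟨n, fun i hi => (hn i hi).trans (and_congr_right fun h => ?_)⟩
      rw [num_lt_add_one_iff]
      exact ⟨le_of_lt, fun h' => lt_of_le_of_ne h' (by rintro rfl; exact hj h)⟩

/-- Every singleton has a canonical index. -/
theorem exists_canonical_singleton (x : M.Num) :
    ∃ e, M.IsCanonical e ∧ ∀ i, M.MemCode i e ↔ i = x := by
  have hs : {i | i = x} ∈ M.sets := BddDef.setOf_mem_sets (.eq (.var 0) (.const x))
  obtain ⟨e₀, he₀, h₀⟩ := exists_code hs (k := x + 1) (by
    rintro i rfl; exact num_lt_add_one_iff.2 le_rfl)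
  have hS : {e | M.IsTriple e ∧ M.MemCode x e ∧ ∀ i, i < e → M.MemCode i e → i = x} ∈ M.sets := by
    refine BddDef.setOf_mem_sets ?_
    repeat' first
      | apply BddDef.isTriple | apply BddDef.memCode | apply BddDef.and | apply BddDef.ball
      | apply BddDef.imp | apply BddDef.eq | apply TermFun.var | apply TermFun.const
  obtain ⟨e, ⟨he, hx, hi⟩, hmin⟩ := exists_least hS ⟨e₀, he₀, (h₀ x).2 rfl, fun i _ h => (h₀ i).1 h⟩
  refine ⟨e, ⟨he, fun e' he' ht => ?_⟩, fun i => ⟨fun h => hi i (lt_of_memCode h) h, ?_⟩⟩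
  · by_contra! hc
    refine hmin e' he' ⟨ht, (hc x (lt_of_memCode hx)).1 hx, fun i hie' h => ?_⟩
    have hie := hie'.trans he'
    exact hi i hie ((hc i hie).2 h)
  · rintro rfl
    exact hx

end Coding

/-! ### Arithmetical definability from `Σ⁰₁` comprehension -/

section Arithmetical

variable {M : L2Structure.{u}}

theorem TermFun.exists_support {f} (hf : TermFun (M := M) f) :
    ∃ a, ∀ v v' : ℕ → M.Num, (∀ i < a, v i = v' i) → f v = f v' := by
  induction hf with
  | var n => exact ⟨n + 1, fun v v' h => h n n.lt_succ_self⟩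
  | const c => exact ⟨0, fun _ _ _ => rfl⟩
  | add _ _ ih₁ ih₂ =>
    obtain ⟨a, ha⟩ := ih₁
    obtain ⟨b, hb⟩ := ih₂
    exact ⟨a + b, fun v v' h => congr_arg₂ _ (ha v v' fun i hi => h i (by omega))
      (hb v v' fun i hi => h i (by omega))⟩
  | mul _ _ ih₁ ih₂ =>
    obtain ⟨a, ha⟩ := ih₁
    obtain ⟨b, hb⟩ := ih₂
    exact ⟨a + b, fun v v' h => congr_arg₂ _ (ha v v' fun i hi => h i (by omega))
      (hb v v' fun i hi => h i (by omega))⟩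

/-- A bounded definable property depends on finitely many variables only. -/
theorem BddDef.exists_support {P} (hP : BddDef (M := M) P) :
    ∃ a, ∀ v v' : ℕ → M.Num, (∀ i < a, v i = v' i) → (P v ↔ P v') := by
  induction hP with
  | eq hf hg =>
    obtain ⟨a, ha⟩ := hf.exists_support
    obtain ⟨b, hb⟩ := hg.exists_support
    exact ⟨a + b, fun v v' h => by
      beta_reduce
      rw [ha v v' fun i hi => h i (by omega), hb v v' fun i hi => h i (by omega)]⟩
  | lt hf hg =>
    obtain ⟨a, ha⟩ := hf.exists_support
    obtain ⟨b, hb⟩ := hg.exists_support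
    exact ⟨a + b, fun v v' h => by
      beta_reduce
      rw [ha v v' fun i hi => h i (by omega), hb v v' fun i hi => h i (by omega)]⟩
  | mem _ hf =>
    obtain ⟨a, ha⟩ := hf.exists_support
    exact ⟨a, fun v v' h => by beta_reduce; rw [ha v v' h]⟩
  | not _ ih =>
    obtain ⟨a, ha⟩ := ih
    exact ⟨a, fun v v' h => not_congr (ha v v' h)⟩
  | and _ _ ih₁ ih₂ =>
    obtain ⟨a, ha⟩ := ih₁
    obtain ⟨b, hb⟩ := ih₂
    exact ⟨a + b, fun v v' h => and_congr (ha v v' fun i hi => h i (by omega))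
      (hb v v' fun i hi => h i (by omega))⟩
  | @bex f P hf _ ih =>
    obtain ⟨a, ha⟩ := hf.exists_support
    obtain ⟨b, hb⟩ := ih
    refine ⟨a + b, fun v v' h => exists_congr fun x => ?_⟩
    rw [ha v v' fun i hi => h i (by omega)]
    refine and_congr_right fun _ => hb (extend x v) (extend x v') fun i hi => ?_
    cases i with
    | zero => rfl
    | succ i => exact h i (by omega)

variable [hM : IsRCA M]

/-- All variables but the first can be contracted to a single one, by pairing. -/
theorem BddDef.exists_contraction (a : ℕ) : ∀ P : (ℕ → M.Num) → Prop, BddDef P →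
    (∀ v v' : ℕ → M.Num, (∀ i < a + 2, v i = v' i) → (P v ↔ P v')) →
    ∃ (R : M.Num → M.Num → Prop) (f : (ℕ → M.Num) → M.Num),
      BddDef (fun v => R (v 0) (v 1)) ∧ TermFun f ∧ ∀ x v, P (extend x v) ↔ R x (f v) := by
  induction a with
  | zero =>
    intro P hP h
    refine ⟨fun x n => P (extend x fun _ => n), fun v => v 0, ?_, .var 0, fun x v => h _ _ ?_⟩
    · refine hP.comp (g := fun i v => extend (v 0) (fun _ => v 1) i) ?_
      rintro (_ | i)
      exacts [.var 0, .var 1]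
    · rintro (_ | _ | i) hi
      exacts [rfl, rfl, by omega]
  | succ a ih =>
    intro P hP h
    let P' : (ℕ → M.Num) → Prop := fun w => ∃ y, y < w 1 + 1 ∧ ∃ z, z < w 1 + 1 ∧
      w 1 = M.pair y z ∧ P (extend (w 0) (extend y (extend z fun n => w (n + 2))))
    have hP' : BddDef P' := by
      refine .bex (P := fun y w => ∃ z, z < w 1 + 1 ∧ w 1 = M.pair y z ∧
        P (extend (w 0) (extend y (extend z fun n => w (n + 2))))) (.add (.var 1) (.const 1)) ?_
      refine .bex (P := fun z w => w 2 = M.pair (w 0) z ∧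
        P (extend (w 1) (extend (w 0) (extend z fun n => w (n + 3)))))
        (.add (.var 2) (.const 1)) ?_
      refine .and (.eq (.var 3) (.pair (.var 1) (.var 0))) ?_
      refine hP.comp (g := fun i v =>
        extend (v 2) (extend (v 1) (extend (v 0) fun n => v (n + 4))) i) ?_
      rintro (_ | _ | _ | i)
      exacts [.var 2, .var 1, .var 0, .var (i + 4)]
    have hs : ∀ v v' : ℕ → M.Num, (∀ i < a + 2, v i = v' i) → (P' v ↔ P' v') := by
      intro v v' hv
      simp only [P', hv 1 (by omega), hv 0 (by omega)]
      refine exists_congr fun y => and_congr_right fun _ => exists_congr fun z =>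
        and_congr_right fun _ => and_congr_right fun _ => h _ _ ?_
      rintro (_ | _ | _ | i) hi
      exacts [rfl, rfl, rfl, hv _ (by omega)]
    obtain ⟨R, f, hR, hf, hRf⟩ := ih P' hP' hs
    refine ⟨R, fun v => f (extend (M.pair (v 0) (v 1)) fun n => v (n + 2)), hR,
      hf.comp (g := fun i v => extend (M.pair (v 0) (v 1)) (fun n => v (n + 2)) i) ?_,
      fun x v => ?_⟩
    · rintro (_ | i)
      exacts [.pair (.var 0) (.var 1), .var (i + 2)]
    · rw [← hRf]
      have hv : v = extend (v 0) (extend (v 1) fun n => v (n + 2)) := by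
        funext i
        rcases i with _ | _ | i <;> rfl
      constructor
      · intro hP
        refine ⟨v 0, num_lt_add_one_iff.2 (le_pair_left _ _), v 1,
          num_lt_add_one_iff.2 (le_pair_right _ _), rfl, ?_⟩
        rw [hv] at hP
        exact hP
      · rintro ⟨y, -, z, -, hyz, hP⟩
        obtain ⟨rfl, rfl⟩ := pair_inj.1 hyz
        rw [hv]
        exact hP

/-- `Σ⁰₁` comprehension makes bounded definability closed under number quantifiers: the tuples
that satisfy an existential property form a set. -/
theorem BddDef.ex (hc : M.Sigma01Comp) {P : M.Num → (ℕ → M.Num) → Prop}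
    (h : BddDef fun v => P (v 0) fun n => v (n + 1)) : BddDef fun v => ∃ a, P a v := by
  obtain ⟨a, ha⟩ := h.exists_support
  obtain ⟨R, f, hR, hf, hRf⟩ := BddDef.exists_contraction a _ h
    fun v v' hv => ha v v' fun i hi => hv i (by omega)
  have hX : {n | ∃ x, R x n} ∈ M.sets := by
    refine hc (fun n x => R x n) (hR.comp (g := fun i v => extend (v 1) (fun _ => v 0) i) ?_)
    rintro (_ | i)
    exacts [.var 1, .var 0]
  exact (BddDef.mem hX hf).congr fun v => exists_congr fun x => (hRf x v).symm

theorem BddDef.all (hc : M.Sigma01Comp) {P : M.Num → (ℕ → M.Num) → Prop}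
    (h : BddDef fun v => P (v 0) fun n => v (n + 1)) : BddDef fun v => ∀ a, P a v :=
  (BddDef.ex hc (P := fun a v => ¬ P a v) h.not).not.congr fun v => by simp

/-- Under `Σ⁰₁` comprehension the truth of an arithmetical formula is definable from its number
variables and from the index of a uniformly definable family of set assignments. -/
theorem Formula.IsArithmetical.bddDef (hc : M.Sigma01Comp) {φ : Formula} (hφ : φ.IsArithmetical)
    {W : M.Num → ℕ → M.sets} (hW : ∀ X, BddDef fun v => v 0 ∈ (W (v 1) X : Set M.Num))
    {g : ℕ → (ℕ → M.Num) → M.Num} (hg : ∀ i, TermFun (g i))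
    {f : (ℕ → M.Num) → M.Num} (hf : TermFun f) :
    BddDef fun w => φ.Realize (fun i => g i w) (W (f w)) := by
  induction φ generalizing g f with
  | eq s t => exact .eq (s.termFun hg) (t.termFun hg)
  | lt s t => exact .lt (s.termFun hg) (t.termFun hg)
  | mem t X =>
    refine (hW X).comp (g := fun i w => extend (t.eval fun i => g i w) (fun _ => f w) i) ?_
    rintro (_ | i)
    exacts [t.termFun hg, hf]
  | neg φ ih => exact .not (ih hφ hg hf)
  | and φ ψ ih₁ ih₂ => exact .and (ih₁ hφ.1 hg hf) (ih₂ hφ.2 hg hf)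
  | or φ ψ ih₁ ih₂ => exact .or (ih₁ hφ.1 hg hf) (ih₂ hφ.2 hg hf)
  | imp φ ψ ih₁ ih₂ => exact .imp (ih₁ hφ.1 hg hf) (ih₂ hφ.2 hg hf)
  | allN φ ih =>
    exact .all hc (P := fun a w => φ.Realize (extend a fun i => g i w) (W (f w)))
      (ih hφ (TermFun.under hg) (hf.comp fun n => .var (n + 1)))
  | exN φ ih =>
    exact .ex hc (P := fun a w => φ.Realize (extend a fun i => g i w) (W (f w)))
      (ih hφ (TermFun.under hg) (hf.comp fun n => .var (n + 1)))
  | allS φ => exact hφ.elim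
  | exS φ => exact hφ.elim

theorem models_ACA0_of_sigma01Comp (hc : M.Sigma01Comp) : M.Models ACA0 := by
  rintro χ (hχ | ⟨φ, hφ, rfl⟩) v V
  · exact hM.models χ hχ v V
  · rw [realize_comprehensionAxiom]
    have h : BddDef fun w : ℕ → M.Num => φ.Realize (extend (w 0) v) V := by
      refine hφ.bddDef hc (W := fun _ => V) (fun X => .mem (V X).2 (.var 0))
        (g := fun i w => extend (w 0) v i) ?_ (f := fun _ => 0) (.const 0)
      rintro (_ | i)
      exacts [.var 0, .const _]
    exact ⟨⟨_, BddDef.setOf_mem_sets (P := fun n => φ.Realize (extend n v) V) h⟩, fun n => Iff.rfl⟩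

end Arithmetical

/-! ### Closures of coded sets and greedy sets -/

section Closure

variable {M : L2Structure.{u}}

/-- The closure of `C ∪ D_e` under the operator `D`, described without quantifying over sets: `x`
belongs to it if, for some bound `k`, the coded finite sets that contain the part of `C ∪ D_e`
below `k` and are closed under the part of `D` below `k` all contain `x`. -/
def L2Structure.closure (M : L2Structure.{u}) (D C : Set M.Num) (e : M.Num) : Set M.Num :=
  {x | ∃ k, ∀ s, (∀ i, i < k → i ∈ C ∨ M.MemCode i e → M.MemCode i s) →
    (∀ p q, M.pair p q < k → M.pair p q ∈ D → (∀ i, M.MemCode i p → M.MemCode i s) →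
      M.MemCode q s) → M.MemCode x s}

variable [hM : IsRCA M] {D C : Set M.Num}

theorem bddDef_mem_closure (hc : M.Sigma01Comp) (hD : D ∈ M.sets) (hC : C ∈ M.sets) :
    BddDef fun v => v 0 ∈ M.closure D C (v 1) := by
  unfold L2Structure.closure
  refine BddDef.ex (P := fun k v => ∀ s, (∀ i, i < k → i ∈ C ∨ M.MemCode i (v 1) →
    M.MemCode i s) → (∀ p q, M.pair p q < k → M.pair p q ∈ D →
      (∀ i, M.MemCode i p → M.MemCode i s) → M.MemCode q s) → M.MemCode (v 0) s) hc ?_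
  repeat' first
    | apply BddDef.memCode | exact BddDef.mem hC (.var _)
    | exact BddDef.mem hD (.pair (.var _) (.var _)) | apply BddDef.or
    | apply BddDef.lt | apply BddDef.imp | apply BddDef.all hc
    | apply TermFun.var | apply TermFun.pair

theorem closure_mem_sets (hc : M.Sigma01Comp) (hD : D ∈ M.sets) (hC : C ∈ M.sets) (e : M.Num) :
    M.closure D C e ∈ M.sets := by
  refine BddDef.setOf_mem_sets (P := fun n => n ∈ M.closure D C e)
    ((bddDef_mem_closure hc hD hC).comp (g := fun i v => extend (v 0) (fun _ => e) i) ?_)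
  rintro (_ | i)
  exacts [.var 0, .const e]

theorem subset_closure (e : M.Num) : C ⊆ M.closure D C e := fun i hi =>
  ⟨i + 1, fun _ h _ => h i (num_lt_add_one_iff.2 le_rfl) (.inl hi)⟩

theorem mem_closure_of_memCode {i e : M.Num} (h : M.MemCode i e) : i ∈ M.closure D C e :=
  ⟨i + 1, fun _ h' _ => h' i (num_lt_add_one_iff.2 le_rfl) (.inr h)⟩

/-- Every closed set that contains `C ∪ D_e` contains the closure: its initial segments are coded. -/
theorem closure_subset {E : Set M.Num} (hE : E ∈ M.sets) (hDE : M.IsClosed D E) (hCE : C ⊆ E)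
    {e : M.Num} (he : ∀ i, M.MemCode i e → i ∈ E) : M.closure D C e ⊆ E := by
  rintro x ⟨k, hk⟩
  have hX : {i | i ∈ E ∧ i < k} ∈ M.sets :=
    BddDef.setOf_mem_sets (.and (.mem hE (.var 0)) (.lt (.var 0) (.const k)))
  obtain ⟨s, -, hs⟩ := exists_code hX (k := k) fun i hi => hi.2
  refine ((hs x).1 (hk s ?_ ?_)).1
  · rintro i hi (h | h)
    exacts [(hs i).2 ⟨hCE h, hi⟩, (hs i).2 ⟨he i h, hi⟩]
  · intro p q hpq hD hp
    exact (hs q).2 ⟨hDE p q hD fun i hi => ((hs i).1 (hp i hi)).1,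
      (le_pair_right p q).trans_lt hpq⟩

theorem isClosed_closure (hc : M.Sigma01Comp) (hD : D ∈ M.sets) (hC : C ∈ M.sets) (e : M.Num) :
    M.IsClosed D (M.closure D C e) := by
  intro p q hpq hp
  -- A common bound `k` for the elements of `D_p` exists by induction.
  have key : ∀ n : M.Num, ∃ k, ∀ x, x < n → M.MemCode x p →
      ∀ s, (∀ i, i < k → i ∈ C ∨ M.MemCode i e → M.MemCode i s) →
        (∀ p q, M.pair p q < k → M.pair p q ∈ D → (∀ i, M.MemCode i p → M.MemCode i s) →
          M.MemCode q s) → M.MemCode x s := by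
    refine sigma01_induction ?_ ⟨0, fun x hx => absurd hx (not_lt.2 (num_zero_le x))⟩ ?_
    · repeat' first
        | apply BddDef.memCode | exact BddDef.mem hC (.var _)
        | exact BddDef.mem hD (.pair (.var _) (.var _)) | apply BddDef.or
        | apply BddDef.lt | apply BddDef.imp | apply BddDef.all hc
        | apply TermFun.var | apply TermFun.pair | apply TermFun.const
    · rintro n ⟨k, hk⟩
      by_cases hn : M.MemCode n p
      · obtain ⟨l, hl⟩ := hp n hn
        refine ⟨max k l, fun x hx hxp s h₁ h₂ => ?_⟩
        rcases (num_lt_add_one_iff.1 hx).lt_or_eq with hx | rfl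
        · exact hk x hx hxp s (fun i hi => h₁ i (lt_max_of_lt_left hi))
            fun p q hpq => h₂ p q (lt_max_of_lt_left hpq)
        · exact hl s (fun i hi => h₁ i (lt_max_of_lt_right hi))
            fun p q hpq => h₂ p q (lt_max_of_lt_right hpq)
      · refine ⟨k, fun x hx hxp => hk x (lt_of_le_of_ne (num_lt_add_one_iff.1 hx) ?_) hxp⟩
        rintro rfl
        exact hn hxp
  obtain ⟨k, hk⟩ := key p
  refine ⟨max k (M.pair p q + 1), fun s h₁ h₂ =>
    h₂ p q (lt_max_of_lt_right (num_lt_add_one_iff.2 le_rfl)) hpq fun i hi => ?_⟩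
  exact hk i (lt_of_memCode hi) hi s (fun i hi => h₁ i (lt_max_of_lt_left hi))
    fun p q hpq => h₂ p q (lt_max_of_lt_left hpq)

/-- Greedy construction: for a definable property `G` of coded finite sets there is a set `B`
that contains a number `x` exactly if `(B ∩ [0, x)) ∪ {x}` has the property. -/
theorem exists_greedy (hc : M.Sigma01Comp) {G : M.Num → Prop} (hG : BddDef fun v => G (v 0))
    (hext : ∀ e e', (∀ i, M.MemCode i e ↔ M.MemCode i e') → G e → G e') :
    ∃ B ∈ M.sets, ∀ x e, (∀ i, M.MemCode i e ↔ (i ∈ B ∧ i < x) ∨ i = x) → (x ∈ B ↔ G e) := by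
  -- `Step s y`: the set `(D_s ∩ [0, y)) ∪ {y}` has the property.
  let Step : M.Num → M.Num → Prop := fun s y =>
    ∃ e, (∀ i, M.MemCode i e ↔ (M.MemCode i s ∧ i < y) ∨ i = y) ∧ G e
  have hStep : BddDef fun v => Step (v 0) (v 1) := by
    refine .ex (P := fun e v => (∀ i, M.MemCode i e ↔ (M.MemCode i (v 0) ∧ i < v 1) ∨ i = v 1) ∧
      G e) hc (.and ?_ hG)
    repeat' first
      | apply BddDef.memCode | apply BddDef.iff | apply BddDef.or | apply BddDef.and
      | apply BddDef.lt | apply BddDef.eq | apply BddDef.all hc | apply TermFun.var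
  have hStep' : ∀ {f g}, TermFun (M := M) f → TermFun g → BddDef fun v => Step (f v) (g v) := by
    intro f g hf hg
    refine hStep.comp (g := extend f fun _ => g) ?_
    rintro (_ | i)
    exacts [hf, hg]
  have step_congr : ∀ s s' y, (∀ i, i < y → (M.MemCode i s ↔ M.MemCode i s')) →
      (Step s y ↔ Step s' y) := fun s s' y h =>
    exists_congr fun e => and_congr_left fun _ => forall_congr' fun i => by
      rw [and_congr_left (h i)]
  -- `Cor s n`: below `n`, the set `D_s` follows the greedy construction.
  let Cor : M.Num → M.Num → Prop := fun s n => ∀ y, y < n → (M.MemCode y s ↔ Step s y)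
  have hCor : ∀ {f g}, TermFun (M := M) f → TermFun g → BddDef fun v => Cor (f v) (g v) := by
    intro f g hf hg
    refine .ball (P := fun y v => M.MemCode y (f v) ↔ Step (f v) y) hg ?_
    have hf' : TermFun fun v => f fun n => v (n + 1) := hf.comp fun n => .var (n + 1)
    exact .iff (.memCode (.var 0) hf') (hStep' hf' (.var 0))
  have exists_cor : ∀ n, ∃ s, Cor s n := by
    refine sigma01_induction (hCor (.var 1) (.var 0))
      ⟨0, fun y hy => absurd hy (not_lt.2 (num_zero_le y))⟩ ?_
    rintro n ⟨s, hs⟩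
    have hX : {i | (M.MemCode i s ∧ i < n) ∨ (i = n ∧ Step s i)} ∈ M.sets := by
      refine BddDef.setOf_mem_sets ?_
      repeat' first
        | apply hStep' | apply BddDef.memCode | apply BddDef.or | apply BddDef.and
        | apply BddDef.lt | apply BddDef.eq | apply TermFun.var | apply TermFun.const
    obtain ⟨s', -, hs'⟩ := exists_code hX (k := n + 1) (by
      rintro i (h | h)
      exacts [num_lt_add_one_iff.2 h.2.le, num_lt_add_one_iff.2 h.1.le])
    have hlt : ∀ i, i < n → (M.MemCode i s' ↔ M.MemCode i s) := fun i hi =>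
      (hs' i).trans ⟨fun h => h.elim And.left fun h => absurd h.1 hi.ne, fun h => .inl ⟨h, hi⟩⟩
    refine ⟨s', fun y hy => ?_⟩
    rcases (num_lt_add_one_iff.1 hy).lt_or_eq with hy | rfl
    · rw [hlt y hy, step_congr s' s y fun i hi => hlt i (hi.trans hy), hs y hy]
    · rw [step_congr s' s y hlt, hs' y]
      exact ⟨fun h => h.elim (fun h => absurd h.2 (lt_irrefl _)) And.right, fun h => .inr ⟨rfl, h⟩⟩
  have cor_unique : ∀ s s' n n', Cor s n → Cor s' n' →
      ∀ y, y < n → y < n' → (M.MemCode y s ↔ M.MemCode y s') := by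
    intro s s' n n' hs hs' y hy hy'
    by_contra hne
    have hX : {y | y < n ∧ y < n' ∧ ¬ (M.MemCode y s ↔ M.MemCode y s')} ∈ M.sets := by
      refine BddDef.setOf_mem_sets ?_
      repeat' first
        | apply BddDef.memCode | apply BddDef.not | apply BddDef.iff | apply BddDef.and
        | apply BddDef.lt | apply TermFun.var | apply TermFun.const
    obtain ⟨x, ⟨hx, hx', hxne⟩, hmin⟩ := exists_least hX ⟨y, hy, hy', hne⟩
    refine hxne ?_
    rw [hs x hx, hs' x hx']
    refine step_congr s s' x fun i hi => ?_
    by_contra h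
    exact hmin i hi ⟨hi.trans hx, hi.trans hx', h⟩
  refine ⟨{x | ∃ s, Cor s (x + 1) ∧ M.MemCode x s}, BddDef.setOf_mem_sets
    (.ex hc (P := fun s v => Cor s (v 0 + 1) ∧ M.MemCode (v 0) s)
      (.and (hCor (.var 0) (.add (.var 1) (.const 1))) (.memCode (.var 1) (.var 0)))), ?_⟩
  have hB : ∀ s n, Cor s n → ∀ x, x < n →
      ((∃ s, Cor s (x + 1) ∧ M.MemCode x s) ↔ M.MemCode x s) := by
    intro s n hs x hx
    have hx1 : x < x + 1 := num_lt_add_one_iff.2 le_rfl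
    refine ⟨fun ⟨s', hs', h⟩ => (cor_unique s' s _ _ hs' hs x hx1 hx).1 h, fun h => ?_⟩
    exact ⟨s, fun y hy => hs y (hy.trans_le (num_add_one_le_iff.2 hx)), h⟩
  intro x e he
  obtain ⟨s, hs⟩ := exists_cor (x + 1)
  have hx1 : x < x + 1 := num_lt_add_one_iff.2 le_rfl
  have he' : ∀ i, M.MemCode i e ↔ (M.MemCode i s ∧ i < x) ∨ i = x := fun i => by
    rw [he i]
    exact or_congr_left (and_congr_left fun hi => hB s _ hs i (hi.trans hx1))
  refine (hB s _ hs x hx1).trans ((hs x hx1).trans ⟨?_, fun h => ⟨e, he', h⟩⟩)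
  rintro ⟨e', h, hG⟩
  exact hext e' e (fun i => (h i).trans (he' i).symm) hG

end Closure

/-! ### The scheme `CE` and arithmetical comprehension -/

section CE

variable {M : L2Structure.{u}} [hM : IsRCA M]

/-- Maximal closed subsets for a property of finite character that can be decided on uniformly
definable families of sets. -/
theorem exists_maximal_closed (hc : M.Sigma01Comp) {P : M.sets → Prop} (hP : M.FiniteCharacter P)
    (hdef : ∀ W : M.Num → M.sets, (BddDef fun v => v 0 ∈ (W (v 1) : Set M.Num)) →
      BddDef fun v => P (W (v 0)))
    {D A C : M.sets} (hCA : (C : Set M.Num) ⊆ A) (hDC : M.IsClosed D C) (hPC : P C) :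
    ∃ B : M.sets, (C : Set M.Num) ⊆ B ∧ (B : Set M.Num) ⊆ A ∧ M.IsClosed D B ∧ P B ∧
      ∀ E : M.sets, (B : Set M.Num) ⊆ E ∧ (E : Set M.Num) ⊆ A ∧ M.IsClosed D E ∧ P E →
        (E : Set M.Num) ⊆ B := by
  let W : M.Num → M.sets := fun e => ⟨M.closure D C e, closure_mem_sets hc D.2 C.2 e⟩
  have hW : BddDef fun v => v 0 ∈ (W (v 1) : Set M.Num) := bddDef_mem_closure hc D.2 C.2
  -- A property of finite character is inherited by subsets.
  have hmono : ∀ X Y : M.sets, (X : Set M.Num) ⊆ Y → P Y → P X := fun X Y hXY hY =>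
    (hP.2 X).2 fun F hF => (hP.2 Y).1 hY F ⟨hF.1, hF.2.trans hXY⟩
  -- The property `Good` of codes is definable; it says that `D_e` can be extended to a closed set.
  let Good : M.Num → Prop := fun e => (∀ x, x ∈ (W e : Set M.Num) → x ∈ (A : Set M.Num)) ∧ P (W e)
  have hGood : BddDef fun v => Good (v 0) := by
    refine .and (.all hc (P := fun x v => x ∈ (W (v 0) : Set M.Num) → x ∈ (A : Set M.Num))
      (.imp hW (.mem A.2 (.var 0)))) (hdef W hW)
  have good_iff : ∀ e, Good e ↔ ∃ E : M.sets, (C : Set M.Num) ⊆ E ∧ (E : Set M.Num) ⊆ A ∧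
      M.IsClosed D E ∧ P E ∧ ∀ i, M.MemCode i e → i ∈ (E : Set M.Num) := by
    refine fun e => ⟨fun h => ⟨W e, subset_closure e, h.1, isClosed_closure hc D.2 C.2 e, h.2,
      fun i => mem_closure_of_memCode⟩, ?_⟩
    rintro ⟨E, hCE, hEA, hDE, hPE, he⟩
    have hWE : (W e : Set M.Num) ⊆ E := closure_subset E.2 hDE hCE he
    exact ⟨fun x hx => hEA (hWE hx), hmono _ E hWE hPE⟩
  obtain ⟨B, hB, hgreedy⟩ := exists_greedy hc hGood fun e e' h he => by
    obtain ⟨E, h₁, h₂, h₃, h₄, h₅⟩ := (good_iff e).1 he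
    exact (good_iff e').2 ⟨E, h₁, h₂, h₃, h₄, fun i hi => h₅ i ((h i).2 hi)⟩
  have exists_code_insert : ∀ x, ∃ e, ∀ i, M.MemCode i e ↔ (i ∈ B ∧ i < x) ∨ i = x := by
    intro x
    have hX : {i | (i ∈ B ∧ i < x) ∨ i = x} ∈ M.sets := BddDef.setOf_mem_sets
      (.or (.and (.mem hB (.var 0)) (.lt (.var 0) (.const x))) (.eq (.var 0) (.const x)))
    obtain ⟨e, -, he⟩ := exists_code hX (k := x + 1) (by
      rintro i (h | h)
      exacts [num_lt_add_one_iff.2 h.2.le, num_lt_add_one_iff.2 h.le])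
    exact ⟨e, he⟩
  have exists_code_below : ∀ n, ∃ e, ∀ i, M.MemCode i e ↔ i ∈ B ∧ i < n := by
    intro n
    have hX : {i | i ∈ B ∧ i < n} ∈ M.sets := BddDef.setOf_mem_sets
      (.and (.mem hB (.var 0)) (.lt (.var 0) (.const n)))
    obtain ⟨e, -, he⟩ := exists_code hX (k := n) fun i hi => hi.2
    exact ⟨e, he⟩
  -- A number belongs to `B` if some suitable closed set contains it and `B` below it.
  have mem_B : ∀ x (E : M.sets), (C : Set M.Num) ⊆ E → (E : Set M.Num) ⊆ A → M.IsClosed D E →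
      P E → (∀ i ∈ B, i < x → i ∈ (E : Set M.Num)) → x ∈ (E : Set M.Num) → x ∈ B := by
    intro x E h₁ h₂ h₃ h₄ h₅ hx
    obtain ⟨e, he⟩ := exists_code_insert x
    refine (hgreedy x e he).2 ((good_iff e).2 ⟨E, h₁, h₂, h₃, h₄, fun i hi => ?_⟩)
    rcases (he i).1 hi with h | rfl
    exacts [h₅ i h.1 h.2, hx]
  -- Every initial segment of `B` has a suitable closed extension.
  have good_below : ∀ n, ∃ E : M.sets, (C : Set M.Num) ⊆ E ∧ (E : Set M.Num) ⊆ A ∧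
      M.IsClosed D E ∧ P E ∧ ∀ i ∈ B, i < n → i ∈ (E : Set M.Num) := by
    have key : ∀ n, ∀ e, (∀ i, M.MemCode i e ↔ i ∈ B ∧ i < n) → Good e := by
      refine set_induction (BddDef.setOf_mem_sets ?_) ?_ ?_
      · refine .all hc (P := fun e v => (∀ i, M.MemCode i e ↔ i ∈ B ∧ i < v 0) → Good e)
          (.imp ?_ hGood)
        repeat' first
          | apply BddDef.memCode | exact BddDef.mem hB (.var _) | apply BddDef.iff
          | apply BddDef.and | apply BddDef.lt | apply BddDef.all hc | apply TermFun.var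
      · intro e he
        exact (good_iff e).2 ⟨C, subset_rfl, hCA, hDC, hPC, fun i hi =>
          absurd ((he i).1 hi).2 (not_lt.2 (num_zero_le i))⟩
      · intro n ih e he
        by_cases hn : n ∈ B
        · refine (hgreedy n e fun i => ?_).1 hn
          rw [he i, num_lt_add_one_iff, le_iff_lt_or_eq, and_or_left]
          refine or_congr_right ⟨And.right, fun h => ⟨h ▸ hn, h⟩⟩
        · refine ih e fun i => (he i).trans (and_congr_right fun hi => ?_)
          rw [num_lt_add_one_iff]
          exact ⟨fun h => lt_of_le_of_ne h (by rintro rfl; exact hn hi), le_of_lt⟩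
    intro n
    obtain ⟨e, he⟩ := exists_code_below n
    obtain ⟨E, h₁, h₂, h₃, h₄, h₅⟩ := (good_iff e).1 (key n e he)
    exact ⟨E, h₁, h₂, h₃, h₄, fun i hi hin => h₅ i ((he i).2 ⟨hi, hin⟩)⟩
  refine ⟨⟨B, hB⟩, fun c hcC => ?_, fun x hx => ?_, fun p q hpq hp => ?_, ?_, ?_⟩
  · obtain ⟨E, h₁, h₂, h₃, h₄, h₅⟩ := good_below c
    exact mem_B c E h₁ h₂ h₃ h₄ h₅ (h₁ hcC)
  · obtain ⟨E, -, h₂, -, -, h₅⟩ := good_below (x + 1)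
    exact h₂ (h₅ x hx (num_lt_add_one_iff.2 le_rfl))
  · obtain ⟨E, h₁, h₂, h₃, h₄, h₅⟩ := good_below (max p q)
    exact mem_B q E h₁ h₂ h₃ h₄ (fun i hi hiq => h₅ i hi (lt_max_of_lt_right hiq))
      (h₃ p q hpq fun i hi => h₅ i (hp i hi) (lt_max_of_lt_left (lt_of_memCode hi)))
  · refine (hP.2 _).2 fun F ⟨⟨k, hk⟩, hF⟩ => ?_
    obtain ⟨E, -, -, -, h₄, h₅⟩ := good_below k
    exact hmono F E (fun i hi => h₅ i (hF hi) (hk i hi)) h₄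
  · rintro E ⟨hBE, hEA, hDE, hPE⟩ x hx
    refine mem_B x E (fun c hcC => hBE ?_) hEA hDE hPE (fun i hi _ => hBE hi) hx
    obtain ⟨E', h₁, h₂, h₃, h₄, h₅⟩ := good_below c
    exact mem_B c E' h₁ h₂ h₃ h₄ h₅ (h₁ hcC)

theorem realize_ceAxiom_of_sigma01Comp (hc : M.Sigma01Comp) {φ : Formula} (hφ : φ.IsArithmetical)
    (v : ℕ → M.Num) (V : ℕ → M.sets) : (ceAxiom φ).Realize v V := by
  rw [realize_ceAxiom]
  rintro hfc D A C ⟨-, hCA, hDC, hPC⟩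
  refine exists_maximal_closed hc hfc (fun W hW => ?_) hCA hDC hPC
  refine hφ.bddDef hc (W := fun e => extend (W e) V) ?_ (fun i => .const (v i)) (.var 0)
  rintro (_ | X)
  exacts [hW, .mem (V X).2 (.var 0)]

/-- Closed sets that exist by `QF`-`CE` decide a `Σ⁰₁` property.  The operator derives every
`⟨n, s⟩` from `⟨n, 0⟩`, and the ambient set omits `⟨n, s⟩` when `s` witnesses the property for
`n`; so a maximal closed set contains `⟨n, 0⟩` exactly if `n` has no witness. -/
theorem sigma01Comp_of_models_CE_QF (h : M.Models (CE QF)) : M.Sigma01Comp := by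
  intro R hR
  have hR' : ∀ {f g}, TermFun (M := M) f → TermFun g → BddDef fun v => R (f v) (g v) := by
    intro f g hf hg
    refine hR.comp (g := extend f fun _ => g) ?_
    rintro (_ | i)
    exacts [hf, hg]
  let D : Set M.Num := {z | ∃ e, e < z + 1 ∧ ∃ n, n < z + 1 ∧ ∃ s, s < z + 1 ∧
    M.IsCanonical e ∧ M.MemCode (M.pair n 0) e ∧ (∀ i, i < e → M.MemCode i e → i = M.pair n 0) ∧
      z = M.pair e (M.pair n s)}
  let A : Set M.Num := {z | ∃ n, n < z + 1 ∧ ∃ s, s < z + 1 ∧ ¬ R n s ∧ z = M.pair n s}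
  have hD : D ∈ M.sets := by
    refine BddDef.setOf_mem_sets ?_
    repeat' first
      | apply BddDef.isCanonical | apply BddDef.memCode | apply BddDef.bex | apply BddDef.ball
      | apply BddDef.and | apply BddDef.imp | apply BddDef.eq | apply TermFun.var
      | apply TermFun.pair | apply TermFun.const | apply TermFun.add
  have hA : A ∈ M.sets := by
    refine BddDef.setOf_mem_sets ?_
    repeat' first
      | apply hR' | apply BddDef.not | apply BddDef.bex | apply BddDef.and | apply BddDef.eq
      | apply TermFun.var | apply TermFun.pair | apply TermFun.const | apply TermFun.add
  have hC : {n : M.Num | ¬ n = n} ∈ M.sets :=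
    BddDef.setOf_mem_sets (.not (.eq (.var 0) (.var 0)))
  have mem_D : ∀ e n s, M.IsCanonical e → (∀ i, M.MemCode i e ↔ i = M.pair n 0) →
      M.pair e (M.pair n s) ∈ D := fun e n s he hi =>
    ⟨e, num_lt_add_one_iff.2 (le_pair_left _ _),
      n, num_lt_add_one_iff.2 ((le_pair_left n s).trans (le_pair_right _ _)),
      s, num_lt_add_one_iff.2 ((le_pair_right n s).trans (le_pair_right _ _)),
      he, (hi _).2 rfl, fun i _ => (hi i).1, rfl⟩
  have of_mem_D : ∀ e q, M.pair e q ∈ D → ∃ n s, q = M.pair n s ∧ M.MemCode (M.pair n 0) e := by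
    rintro e q ⟨e', -, n, -, s, -, -, hn, -, heq⟩
    obtain ⟨rfl, rfl⟩ := pair_inj.1 heq
    exact ⟨n, s, rfl, hn⟩
  have mem_A : ∀ n s, M.pair n s ∈ A ↔ ¬ R n s := by
    refine fun n s => ⟨?_, fun hns => ⟨n, num_lt_add_one_iff.2 (le_pair_left _ _),
      s, num_lt_add_one_iff.2 (le_pair_right _ _), hns, rfl⟩⟩
    rintro ⟨n', -, s', -, hns, heq⟩
    obtain ⟨rfl, rfl⟩ := pair_inj.1 heq
    exact hns
  -- The property of finite character is trivial.
  have hφ : (Term.zero ≐ Term.zero) ∈ QF := ⟨.eq _ _, trivial, trivial⟩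
  have hce := (realize_ceAxiom (fun _ => 0) (fun _ => ⟨D, hD⟩) _).1 (h _ ⟨_, hφ, rfl⟩ _ _)
  obtain ⟨B, -, hBA, hDB, -, hmax⟩ := hce
    ⟨fun _ _ => rfl, fun _ => ⟨fun _ _ _ => rfl, fun _ => rfl⟩⟩ ⟨D, hD⟩ ⟨A, hA⟩ ⟨_, hC⟩
    ⟨fun z ⟨e, _, n, _, s, _, he, _, _, hz⟩ => ⟨e, _, he, hz⟩, fun n hn => absurd rfl hn,
      fun e q heq hi => by
        obtain ⟨n, s, -, hn⟩ := of_mem_D e q heq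
        exact absurd rfl (hi _ hn), rfl⟩
  have hset : {n | ∃ y, R n y} = {n | ¬ M.pair n 0 ∈ (B : Set M.Num)} := by
    ext n
    constructor
    · rintro ⟨y, hy⟩ hn
      obtain ⟨e, he, hi⟩ := exists_canonical_singleton (M.pair n 0)
      refine (mem_A n y).1 (hBA (hDB e _ (mem_D e n y he hi) fun i h => ?_)) hy
      rw [(hi i).1 h]
      exact hn
    · intro hn
      by_contra! hno
      have hE : {z | z ∈ (B : Set M.Num) ∨ ∃ s, s < z + 1 ∧ z = M.pair n s} ∈ M.sets := by
        refine BddDef.setOf_mem_sets (.or (.mem B.2 (.var 0)) ?_)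
        repeat' first
          | apply BddDef.bex | apply BddDef.eq | apply TermFun.var
          | apply TermFun.pair | apply TermFun.const | apply TermFun.add
      have hin : ∀ s, ∃ t, t < M.pair n s + 1 ∧ M.pair n s = M.pair n t := fun s =>
        ⟨s, num_lt_add_one_iff.2 (le_pair_right _ _), rfl⟩
      refine hn (hmax ⟨_, hE⟩ ⟨fun z hz => .inl hz, ?_, ?_, rfl⟩ (.inr (hin 0)))
      · rintro z (hz | ⟨s, -, rfl⟩)
        · exact hBA hz
        · exact (mem_A n s).2 fun hs => hno ⟨s, hs⟩
      · intro e q heq hi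
        have heq' := heq
        obtain ⟨e', -, n', -, s, -, -, hn', hall, hz⟩ := heq'
        obtain ⟨rfl, rfl⟩ := pair_inj.1 hz
        rcases hi _ hn' with hmem | ⟨t, -, ht⟩
        · refine .inl (hDB _ _ heq fun i h => ?_)
          rw [hall i (lt_of_memCode h) h]
          exact hmem
        · obtain ⟨rfl, -⟩ := pair_inj.1 ht
          exact .inr (hin s)
  rw [hset]
  exact BddDef.setOf_mem_sets (.not (.mem B.2 (.pair (.var 0) (.const 0))))

end CE

end SOA

/-- Over `RCA₀`, the theory `ACA₀` and the schemes `Σ⁰₁`-`CE`, `Σ⁰₀`-`CE` and `QF`-`CE` are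
equivalent: the same models of `RCA₀` satisfy them. -/
theorem corollaryc (M : SOA.L2Structure.{u}) (hM : M.Models SOA.RCA0) :
    List.TFAE [M.Models SOA.ACA0, M.Models (SOA.CE SOA.Sigma01), M.Models (SOA.CE SOA.Sigma00),
      M.Models (SOA.CE SOA.QF)] := by
  have : SOA.IsRCA M := ⟨hM⟩
  tfae_have 1 → 2 := by
    rintro h _ ⟨φ, ⟨θ, hθ, rfl⟩, rfl⟩ v V
    exact SOA.realize_ceAxiom_of_sigma01Comp (SOA.sigma01Comp_of_models_ACA0 h)
      (φ := .exN θ) hθ.isArithmetical v V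
  tfae_have 2 → 3 := by
    rintro h _ ⟨φ, hφ, rfl⟩ v V
    obtain ⟨ψ, hψ, heq⟩ := SOA.Formula.IsSigma00.exists_sigma01 M hφ
    have := h _ ⟨ψ, hψ, rfl⟩ v V
    simpa only [SOA.realize_ceAxiom, heq] using this
  tfae_have 3 → 4 := by
    rintro h _ ⟨φ, hφ, rfl⟩ v V
    exact h _ ⟨φ, hφ.1.isSigma00, rfl⟩ v V
  tfae_have 4 → 1 := fun h =>
    SOA.models_ACA0_of_sigma01Comp (SOA.sigma01Comp_of_models_CE_QF h)
  tfae_finish
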